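/- An **$\hbar$-vertex algebra** is a $\mathbb C[\hbar]$-module $V$ with a nonzero vector $|0\rangle\in V$ and a $\mathbb C[\hbar]$-linear map $a\mapsto Y_\hbar(a,z)=\sum_{n\in\mathbb Z}a_{(n,\hbar)}z^{-n-1}$, $V\to \mathrm{End}_{\mathbb C[\hbar]}(V)[[z,z^{-1}]]$, such that for all $a,b\in V$: $a_{(n,\hbar)}b=0$ for $n\gg0$; $Y_\hbar(|0\rangle,z)=\mathrm{id}_V$, $Y_\hbar(a,z)|0\rangle\in V[[z]]$ and $Y_\hbar(a,z)|0\rangle|_{z=0}=a$; $[T_\hbar,Y_\hbar(a,z)]=(1+\hbar z)\partial_zY_\hbar(a,z)$, where $T_\hbar a:=a_{(-2,\hbar)}|0\rangle$; and there is $N>0$ with $(z-w)^N[Y_\hbar(a,z),Y_\hbar(b,w)]=0$. Write $(x)_{n,\hbar}=\prod_{i=0}^{n-1}(x-i\hbar)$, $\;a\ast_\hbar b:=a_{(-1,\hbar)}b$, and let the $\hbar$-bracket be $$[a_\lambda b]_\hbar:=\sum_{n\ge0}\frac{(\lambda)_{n,\hbar}}{n!}\,a_{(n,\hbar)}b\in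 V[\lambda].$$ For $g\in\mathbb C[\hbar][x]$ the definite sum is $\sum_{\alpha}^{\beta}g(x)\,\delta x:=f(\beta)-f(\alpha)$, where $f\in\mathbb C[\hbar][x]$ is any polynomial with $\frac{f(x+\hbar)-f(x)}{\hbar}=g(x)$ (such $f$ exists and is unique up to a constant). This is extended linearly to polynomials whose coefficients lie in a $\mathbb C[\hbar]$-module $M$, with $\alpha,\beta$ allowed to be $\mathbb C[\hbar]$-linear operators on $M$: $\sum_\alpha^\beta g(x)m\,\delta x=f(\beta)m-f(\alpha)m$. Brackets and products are extended linearly in the coefficients of polynomials in the formal variables. **Theorem.** Let $V$ be an $\hbar$-vertex algebra. Then for all $a,b,c\in V$: 1. (quasi-commutativity) $$a\ast_\hbar b-b\ast_\hbar a=\sum\nolimits_{-T_\hbar-\hbar}^{0}[a_\lambda b]_\hbar\,\delta\lambda ,$$ where $T_\hbar$ acts on the coefficients of $[a_\lambda b]_\hbar$; 2. (quasi-associativity) $$(a\ast_\hbar b)\ast_\hbar c-a\ast_\hbar(b\ast_\hbar c)=\Big(\sum\nolimits_0^{T_\hbar}\delta\lambda\, b\Big)\ast_\hbar[a_\lambda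 c]_\hbar+\Big(\sum\nolimits_0^{T_\hbar}\delta\lambda\, a\Big)\ast_\hbar[b_\lambda c]_\hbar ,$$ where, if $[a_\lambda c]_\hbar=\sum_n\lambda^n q_n$ with $q_n\in V$, then $\big(\sum_0^{T_\hbar}\delta\lambda\, b\big)\ast_\hbar[a_\lambda c]_\hbar:=\sum_n\big(\sum_0^{T_\hbar}\lambda^n b\,\delta\lambda\big)\ast_\hbar q_n$, with $T_\hbar$ acting on $b$; 3. (right non-commutative Wick formula), in $V[\lambda]$, $$[a_\lambda\, b\ast_\hbar c]_\hbar=b\ast_\hbar[a_\lambda c]_\hbar+[a_\lambda b]_\hbar\ast_\hbar c+\sum\nolimits_0^{\lambda+\hbar}\big[[a_\lambda b]_{\hbar\;\mu}\,c\big]_\hbar\,\delta\mu ;$$ 4. (left non-commutative Wick formula), in $V[\lambda]$, $$[a\ast_\hbar b{}_{\;\lambda}\, c]_\hbar=a\ast_\hbar[b_{\lambda+T_\hbar^{(1)}}c]_\hbar+b\ast_\hbar[a_{\lambda+T_\hbar^{(1)}}c]_\hbar+\sum\nolimits_0^{\lambda}\big[b_\mu[a_{\lambda-\mu-\hbar}\,c]_\hbar\big]_\hbar\,\delta\mu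 ,$$ where $T_\hbar^{(1)}$ acts only on the first factor of the product $\ast_\hbar$: if $[b_xc]_\hbar=\sum_n x^nq_n$ with $q_n\in V$, then $a\ast_\hbar[b_{\lambda+T_\hbar^{(1)}}c]_\hbar:=\sum_n\big((\lambda+T_\hbar)^na\big)\ast_\hbar q_n$. -/

import Mathlib

noncomputable section

namespace HbarVA

open Polynomial

/-! ### The ground ring and the calculus of finite differences -/

/-- The ground ring `ℂ[ħ]`. -/
abbrev Ch : Type := Polynomial ℂ

/-- The formal parameter `ħ`. -/
def hbar : Ch := Polynomial.X

/-- The falling factorial `(x)_{n,ħ} = x (x - ħ) ⋯ (x - (n-1)ħ)`, a polynomial in `x` over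
`ℂ[ħ]`. -/
def fallingFactorial (n : ℕ) : Ch[X] :=
  ∏ i ∈ Finset.range n, (X - C ((i : Ch) * hbar))

/-- `f` is an indefinite sum of `g`, i.e. `Δ_ħ f = g` where
`Δ_ħ f (x) = (f (x + ħ) - f x) / ħ`. Since `ħ` is not a zero divisor in `ℂ[ħ][x]`, the division
by `ħ` is expressed by multiplying out. -/
def IsIndefiniteSum (f g : Ch[X]) : Prop :=
  f.comp (X + C hbar) - f = C hbar * g

theorem hbar_ne_zero : hbar ≠ 0 := Polynomial.X_ne_zero

theorem IsIndefiniteSum.add {f₁ f₂ g₁ g₂ : Ch[X]} (h₁ : IsIndefiniteSum f₁ g₁)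
    (h₂ : IsIndefiniteSum f₂ g₂) : IsIndefiniteSum (f₁ + f₂) (g₁ + g₂) := by
  unfold IsIndefiniteSum at *
  rw [add_comp, mul_add, ← h₁, ← h₂]; ring

theorem IsIndefiniteSum.smul {f g : Ch[X]} (r : Ch) (h : IsIndefiniteSum f g) :
    IsIndefiniteSum (r • f) (r • g) := by
  unfold IsIndefiniteSum at *
  rw [smul_comp, ← smul_sub, h, mul_smul_comm]

/-- The only polynomial that is `ħ`-periodic and vanishes at `0` is zero. -/
theorem eq_zero_of_periodic {f : Ch[X]} (h : IsIndefiniteSum f 0) (h0 : f.eval 0 = 0) : f = 0 := by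
  have hk : ∀ k : ℕ, f.eval ((k : Ch) * hbar) = 0 := by
    intro k
    induction k with
    | zero => simpa using h0
    | succ k ih =>
      have h1 := congrArg (fun p : Ch[X] => p.eval ((k : Ch) * hbar)) h
      simp only [eval_sub, eval_comp, eval_add, eval_X, eval_C, mul_zero, eval_zero] at h1
      rw [ih, sub_zero] at h1
      rw [← h1]; push_cast; ring_nf
  refine Polynomial.eq_zero_of_infinite_isRoot f
    (Set.Infinite.mono (s := Set.range fun k : ℕ => (k : Ch) * hbar) ?_ ?_)
  · rintro _ ⟨k, rfl⟩
    exact hk k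
  · refine Set.infinite_range_of_injective fun a b hab => ?_
    exact Nat.cast_injective (mul_right_cancel₀ hbar_ne_zero hab)

theorem isIndefiniteSum_fallingFactorial (n : ℕ) :
    IsIndefiniteSum (fallingFactorial (n + 1)) ((n + 1 : Ch) • fallingFactorial n) := by
  have key : (fallingFactorial (n + 1)).comp (X + C hbar)
      = (X + C hbar) * fallingFactorial n := by
    unfold fallingFactorial
    rw [Finset.prod_range_succ', mul_comp, prod_comp, mul_comm]
    congr 1
    · simp
    · refine Finset.prod_congr rfl fun i _ => ?_
      rw [sub_comp, X_comp, C_comp]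
      simp only [Nat.cast_add, Nat.cast_one, map_mul, map_add, map_one]
      ring
  unfold IsIndefiniteSum
  have hs : fallingFactorial (n + 1) = fallingFactorial n * (X - C ((n : Ch) * hbar)) :=
    Finset.prod_range_succ _ _
  rw [key, hs, smul_eq_C_mul]
  simp only [map_mul, map_add, map_one]
  ring

theorem monic_fallingFactorial (n : ℕ) : (fallingFactorial n).Monic :=
  monic_prod_of_monic _ _ fun _ _ => monic_X_sub_C _

theorem natDegree_fallingFactorial (n : ℕ) : (fallingFactorial n).natDegree = n := by
  unfold fallingFactorial
  rw [natDegree_prod_of_monic _ _ fun _ _ => monic_X_sub_C _]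
  simp only [natDegree_X_sub_C, Finset.sum_const, Finset.card_range, smul_eq_mul, mul_one]

theorem exists_isIndefiniteSum (g : Ch[X]) : ∃ f : Ch[X], IsIndefiniteSum f g := by
  have main : ∀ n : ℕ, ∀ g : Ch[X], g.degree < n → ∃ f : Ch[X], IsIndefiniteSum f g := by
    intro n
    induction n with
    | zero =>
      intro g hg
      have : g = 0 := by
        rw [← degree_eq_bot]
        exact Nat.WithBot.lt_zero_iff.mp (by simpa using hg)
      exact ⟨0, by simp [IsIndefiniteSum, this]⟩
    | succ n ih =>
      intro g hg
      obtain ⟨f, hf⟩ := ih (g - g.coeff n • fallingFactorial n) (by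
        rw [degree_lt_iff_coeff_zero] at hg ⊢
        intro m hm
        rcases hm.eq_or_lt with rfl | hm'
        · have := (monic_fallingFactorial n).coeff_natDegree
          rw [natDegree_fallingFactorial] at this
          simp [this]
        · rw [coeff_sub, hg m hm', coeff_smul,
            coeff_eq_zero_of_natDegree_lt (p := fallingFactorial n)
              (by rwa [natDegree_fallingFactorial]), smul_zero, sub_zero])
      have hs := ((isIndefiniteSum_fallingFactorial n).smul
        (g.coeff n * C ((n + 1 : ℂ)⁻¹)))
      have hn : (C ((n + 1 : ℂ)⁻¹) : Ch) * ((n : Ch) + 1) = 1 := by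
        have : ((n : Ch) + 1) = C ((n : ℂ) + 1) := by simp
        rw [this, ← C_mul, inv_mul_cancel₀ (Nat.cast_add_one_ne_zero n), C_1]
      rw [smul_smul, mul_assoc, hn, mul_one] at hs
      exact ⟨_, by simpa using hf.add hs⟩
  exact main (g.natDegree + 1) g
    (lt_of_le_of_lt degree_le_natDegree (by exact_mod_cast Nat.lt_succ_self _))

theorem existsUnique_isIndefiniteSum (g : Ch[X]) :
    ∃! f : Ch[X], IsIndefiniteSum f g ∧ f.eval 0 = 0 := by
  obtain ⟨f, hf⟩ := exists_isIndefiniteSum g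
  refine ⟨f - C (f.eval 0), ⟨?_, by simp⟩, ?_⟩
  · unfold IsIndefiniteSum at *
    rw [sub_comp, C_comp, ← hf]; ring
  · rintro f' ⟨hf', h0⟩
    rw [← sub_eq_zero]
    refine eq_zero_of_periodic ?_ (by simp [h0])
    unfold IsIndefiniteSum at *
    rw [sub_comp, sub_comp, C_comp, mul_zero]
    linear_combination hf' - hf

/-- The indefinite sum of a polynomial, normalised to vanish at `0`. -/
def indefSum : Ch[X] →ₗ[Ch] Ch[X] where
  toFun g := (existsUnique_isIndefiniteSum g).choose
  map_add' g₁ g₂ := by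
    have h₁ := (existsUnique_isIndefiniteSum g₁).choose_spec.1
    have h₂ := (existsUnique_isIndefiniteSum g₂).choose_spec.1
    refine ((existsUnique_isIndefiniteSum (g₁ + g₂)).choose_spec.2 _ ⟨h₁.1.add h₂.1, ?_⟩).symm
    rw [eval_add, h₁.2, h₂.2, add_zero]
  map_smul' r g := by
    have h := (existsUnique_isIndefiniteSum g).choose_spec.1
    refine ((existsUnique_isIndefiniteSum (r • g)).choose_spec.2 _ ⟨h.1.smul r, ?_⟩).symm
    rw [eval_smul, h.2, smul_zero]

theorem indefSum_spec (g : Ch[X]) :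
    IsIndefiniteSum (indefSum g) g ∧ (indefSum g).eval 0 = 0 :=
  (existsUnique_isIndefiniteSum g).choose_spec.1

/-! ### Polynomials with coefficients in a module, substitution and definite sums -/

section Module

variable {M N : Type*} [AddCommGroup M] [Module Ch M] [AddCommGroup N] [Module Ch N]

/-- Constant polynomials, `M → M[x]`. -/
def const (M : Type*) [AddCommGroup M] [Module Ch M] : M →ₗ[Ch] PolynomialModule Ch M :=
  PolynomialModule.lsingle Ch 0

/-- Multiplication by the variable on `M[x]`. -/
def mulVar (M : Type*) [AddCommGroup M] [Module Ch M] : Module.End Ch (PolynomialModule Ch M) :=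
  Algebra.lsmul Ch Ch (PolynomialModule Ch M) (X : Ch[X])

/-- Applying a linear map `f` to the coefficients of a polynomial, `M[x] → N[x]`. -/
def mapCoeff (f : M →ₗ[Ch] N) : PolynomialModule Ch M →ₗ[Ch] PolynomialModule Ch N :=
  PolynomialModule.map Ch f

/-- Substitution of an operator `A` on `N` for the variable in a polynomial with coefficients
in `M`, where the coefficients are first mapped to `N` by `ι`: `∑ mₙ xⁿ ↦ ∑ Aⁿ (ι mₙ)`. -/
def subst (ι : M →ₗ[Ch] N) (A : Module.End Ch N) : PolynomialModule Ch M →ₗ[Ch] N :=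
  (Finsupp.lsum Ch fun n : ℕ => (A ^ n) ∘ₗ ι) ∘ₗ
    (PolynomialModule.coeffLinearEquiv Ch Ch).toLinearMap

/-- The definite sum `∑_A^B p(x) δx` of `p ∈ M[x]` with extremes `A`, `B` operators on `M`. It is
linear in `p`, and for `p = g(x) m` with `g ∈ ℂ[ħ][x]` and `m ∈ M` it is `f(B) m - f(A) m`, where
`f` is an indefinite sum of `g`. -/
def defSum (A B : Module.End Ch M) : PolynomialModule Ch M →ₗ[Ch] M :=
  (Finsupp.lsum Ch fun n : ℕ =>
    aeval B (indefSum (X ^ n)) - aeval A (indefSum (X ^ n))) ∘ₗ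
      (PolynomialModule.coeffLinearEquiv Ch Ch).toLinearMap

end Module

/-! ### Formal distributions -/

/-- `U`-valued formal distributions `a(z) = ∑_{n ∈ ℤ} a₍ₙ₎ z^{-n-1}` in one variable; the function
gives the coefficients `n ↦ a₍ₙ₎`. -/
abbrev Dist (U : Type*) : Type _ := ℤ → U

/-- `U`-valued formal distributions `∑_{m, n ∈ ℤ} a₍ₘ,ₙ₎ z^{-m-1} w^{-n-1}` in two variables. -/
abbrev Dist₂ (U : Type*) : Type _ := ℤ → ℤ → U

section Dist

variable {U : Type*}

/-- The derivative `∂_z a(z)`. -/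
def Dist.deriv [AddCommGroup U] (a : Dist U) : Dist U := fun n => (-n) • a (n - 1)

/-- The product `z a(z)`. -/
def Dist.mulZ (a : Dist U) : Dist U := fun n => a (n + 1)

/-- The product `(z - w) a(z, w)`. -/
def Dist₂.mulZSubW [AddCommGroup U] (a : Dist₂ U) : Dist₂ U :=
  fun m n => a (m + 1) n - a m (n + 1)

/-- The commutator `[a(z), b(w)]`. -/
def Dist.comm [Ring U] (a b : Dist U) : Dist₂ U := fun m n => a m * b n - b n * a m

end Dist

/-! ### `ħ`-vertex algebras -/

/-- The operator `T_ħ a = a_{(-2,ħ)} |0⟩`. -/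
def translationOp {V : Type*} [AddCommGroup V] [Module Ch V] (vac : V) (Y : V →ₗ[Ch] Dist (Module.End Ch V)) : Module.End Ch V :=
  LinearMap.applyₗ vac ∘ₗ LinearMap.proj (-2) ∘ₗ Y

/-- The structure of an `ħ`-vertex algebra on a `ℂ[ħ]`-module `V`. The value `Y a n` is the
operator `a_{(n,ħ)}`, the coefficient of `z^{-n-1}` in `Y_ħ(a, z)`. -/
structure HVertexAlgebra (V : Type*) [AddCommGroup V] [Module Ch V] where
  /-- The vacuum vector. -/
  vac : V
  /-- The map `a ↦ Y_ħ(a, z)`. -/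
  Y : V →ₗ[Ch] Dist (Module.End Ch V)
  vac_ne_zero : vac ≠ 0
  field : ∀ a b : V, ∃ N : ℤ, ∀ n ≥ N, Y a n b = 0
  /-- `Y_ħ(|0⟩, z) = id`. -/
  vac_left : Y vac = Pi.single (-1) 1
  /-- `Y_ħ(a, z)|0⟩ ∈ V[[z]]`. -/
  vac_right : ∀ (a : V) (n : ℤ), 0 ≤ n → Y a n vac = 0
  /-- `Y_ħ(a, z)|0⟩` takes the value `a` at `z = 0`. -/
  vac_right_zero : ∀ a : V, Y a (-1) vac = a
  /-- `[T_ħ, Y_ħ(a, z)] = (1 + ħ z) ∂_z Y_ħ(a, z)`. -/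
  translation : ∀ a : V, (fun n => translationOp vac Y * Y a n - Y a n * translationOp vac Y)
    = Dist.deriv (Y a) + hbar • Dist.mulZ (Dist.deriv (Y a))
  /-- `(z - w)^N [Y_ħ(a, z), Y_ħ(b, w)] = 0` for some `N > 0`. -/
  locality : ∀ a b : V, ∃ N : ℕ, 0 < N ∧ Dist₂.mulZSubW^[N] (Dist.comm (Y a) (Y b)) = 0

namespace HVertexAlgebra

variable {V : Type*} [AddCommGroup V] [Module Ch V] (H : HVertexAlgebra V)

/-- The operator `T_ħ a = a_{(-2,ħ)} |0⟩` of an `ħ`-vertex algebra. -/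
def T : Module.End Ch V := translationOp H.vac H.Y

/-- The product `a ∗_ħ b = a_{(-1,ħ)} b`. -/
def star : V →ₗ[Ch] V →ₗ[Ch] V := LinearMap.proj (-1) ∘ₗ H.Y

/-- The product `∗_ħ` as a map `V ⊗ V → V`. -/
def starTensor : TensorProduct Ch V V →ₗ[Ch] V := TensorProduct.lift H.star

/-- The operator `T_ħ^{(1)}` on `V ⊗ V`, acting on the first factor. -/
def T₁ : Module.End Ch (TensorProduct Ch V V) := LinearMap.rTensor V H.T

/-- The `n`-th summand `(λ)_{n,ħ} / n! · a_{(n,ħ)} b` of the `ħ`-bracket. -/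
def bracketTerm (a b : V) (n : ℕ) : PolynomialModule Ch V :=
  ((n.factorial : ℂ)⁻¹ • fallingFactorial n) • const V (H.Y a n b)

theorem bracketTerm_support_finite (a b : V) : (Function.support (H.bracketTerm a b)).Finite := by
  obtain ⟨N, hN⟩ := H.field a b
  refine (Set.finite_lt_nat N.toNat).subset fun n hn => ?_
  by_contra h
  refine hn ?_
  have : N ≤ (n : ℤ) := by
    have h' : ¬ n < N.toNat := h
    omega
  simp [bracketTerm, hN n this]

/-- The `ħ`-bracket `[a_λ b]_ħ = ∑_{n ≥ 0} (λ)_{n,ħ} / n! · a_{(n,ħ)} b ∈ V[λ]` (a finite sum),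
as a `ℂ[ħ]`-bilinear map. -/
def bracket : V →ₗ[Ch] V →ₗ[Ch] PolynomialModule Ch V :=
  LinearMap.mk₂ Ch (fun a b => ∑ᶠ n : ℕ, H.bracketTerm a b n)
    (fun a a' b => by
      rw [← finsum_add_distrib (H.bracketTerm_support_finite a b)
        (H.bracketTerm_support_finite a' b)]
      exact finsum_congr fun n => by simp [bracketTerm])
    (fun r a b => by
      rw [smul_finsum' r (H.bracketTerm_support_finite a b)]
      exact finsum_congr fun n => by simp [bracketTerm, smul_comm r])
    (fun a b b' => by
      rw [← finsum_add_distrib (H.bracketTerm_support_finite a b)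
        (H.bracketTerm_support_finite a b')]
      exact finsum_congr fun n => by simp [bracketTerm])
    (fun r a b => by
      rw [smul_finsum' r (H.bracketTerm_support_finite a b)]
      exact finsum_congr fun n => by simp [bracketTerm, smul_comm r])

/-- For `q(x) = ∑ₙ qₙ xⁿ ∈ V[x]` and `b ∈ V`, the element
`(∑_0^{T_ħ} δx b) ∗_ħ q(x) = ∑ₙ (∑_0^{T_ħ} xⁿ δx b) ∗_ħ qₙ` of `V`; here `T_ħ` acts on `b`. -/
def sumStar (b : V) (q : PolynomialModule Ch V) : V :=
  H.starTensor (defSum 0 H.T₁ (mapCoeff (TensorProduct.mk Ch V V b) q))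

/-- For `q(x) ∈ V[x]` and `a ∈ V`, the element `a ∗_ħ q(λ + T_ħ^{(1)})` of `V[λ]`, where
`T_ħ^{(1)}` acts on the left factor `a`. -/
def starShift (a : V) (q : PolynomialModule Ch V) : PolynomialModule Ch V :=
  mapCoeff H.starTensor
    (subst (const _) (mulVar (TensorProduct Ch V V) + mapCoeff H.T₁)
      (mapCoeff (TensorProduct.mk Ch V V a) q))

/-- For `u(λ) = ∑ uᵢ λⁱ ∈ V[λ]` and `c ∈ V`, the element `[u(λ)_μ c]_ħ = ∑ λⁱ [uᵢ_μ c]_ħ` of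
`V[λ][μ]`. -/
def bracketLeft (u : PolynomialModule Ch V) (c : V) :
    PolynomialModule Ch (PolynomialModule Ch V) :=
  subst (mapCoeff (const V)) (mapCoeff (mulVar V)) (mapCoeff (H.bracket.flip c) u)

/-- For `q(x) = ∑ qᵢ xⁱ ∈ V[x]` and `b ∈ V`, the element
`[b_μ q(λ - μ - ħ)]_ħ = ∑ (λ - μ - ħ)ⁱ [b_μ qᵢ]_ħ` of `V[λ][μ]`. -/
def bracketRight (b : V) (q : PolynomialModule Ch V) :
    PolynomialModule Ch (PolynomialModule Ch V) :=
  subst (mapCoeff (const V)) (mapCoeff (mulVar V) - mulVar (PolynomialModule Ch V) - hbar • 1)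
    (mapCoeff (H.bracket b) q)

end HVertexAlgebra

end HbarVA

end

noncomputable section

namespace HbarVA

open Polynomial

/-! ### Divided falling factorials -/

/-! The theorem reduces to two operator identities, after which only finite difference calculus
remains.

The first is the commutator formula: by locality `[Y(a,z), Y(b,w)]` is determined by the residues in
`z` of its products with `(z-w)^j`, and such a residue equals `(1+ħw)^(j+1) Y(a_(j) b, w)`
(`product_eq`). The second is `Y(a ∗ b, z) = :Y(a,z)Y(b,z):` (`Y_star`). Both rest on Goddard's
argument: a field that kills the vacuum and is local with every `Y(c,w)` is zero. For the first
identity, locality of the residue is Dong's lemma, and translation covariance reduces the vacuum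
condition to the constant term. For the second, only locality of the vectors obtained from the
vacuum is needed.

On the calculus side, `(x)_{n,ħ}/n!` plays the role of `x^n/n!`: indefinite summation raises the
index by one, and Chu–Vandermonde replaces the binomial theorem for commuting operators. In
particular `Y(a,z)|0⟩ = ∑ (T)_p/p! a z^p`, formally `(1+ħz)^(T/ħ) a`.

Quasi-commutativity and the right Wick formula come from the commutator formula, for `[a_(-1),
b_(-1)]` on the vacuum and for `[a_(m), b_(-1)]` with `m ≥ 0`. Quasi-associativity and the left Wick
formula are the modes `m = -1` and `m ≥ 0` of the normally ordered product; the last also needs a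
discrete beta integral (`sum_betaSum_mul_divFF`). -/

/-- The divided falling factorial `(x)_{n,ħ} / n!`. -/
def divFF (n : ℕ) : Ch[X] := (n.factorial : ℂ)⁻¹ • fallingFactorial n

theorem divFF_zero : divFF 0 = 1 := by simp [divFF, fallingFactorial]

theorem succ_smul_divFF (n : ℕ) :
    (n + 1) • divFF (n + 1) = (X - C ((n : Ch) * hbar)) * divFF n := by
  have hs : fallingFactorial (n + 1) = fallingFactorial n * (X - C ((n : Ch) * hbar)) :=
    Finset.prod_range_succ _ _
  have hn : ((n : ℂ) + 1) ≠ 0 := Nat.cast_add_one_ne_zero n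
  have e : (((n + 1 : ℕ) : ℂ) * ((n + 1).factorial : ℂ)⁻¹) = (n.factorial : ℂ)⁻¹ := by
    rw [Nat.factorial_succ]
    push_cast
    field_simp
  rw [divFF, divFF, hs, ← Nat.cast_smul_eq_nsmul ℂ, smul_smul, e, mul_smul_comm, mul_comm]

theorem indefSum_unique {f g : Ch[X]} (h : IsIndefiniteSum f g) (h0 : f.eval 0 = 0) :
    indefSum g = f :=
  (existsUnique_isIndefiniteSum g).unique (indefSum_spec g) ⟨h, h0⟩

theorem isIndefiniteSum_divFF (n : ℕ) : IsIndefiniteSum (divFF (n + 1)) (divFF n) := by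
  have h := (isIndefiniteSum_fallingFactorial n).smul (C ((n + 1).factorial : ℂ)⁻¹)
  have hn : ((n : ℂ) + 1) ≠ 0 := Nat.cast_add_one_ne_zero n
  have e1 (r : ℂ) (p : Ch[X]) : (C r : Ch) • p = r • p := by
    rw [← Polynomial.algebraMap_eq, algebraMap_smul]
  rw [smul_smul, e1] at h
  have e2 : (C (((n + 1).factorial : ℂ)⁻¹) : Ch) * ((n : Ch) + 1) = C ((n.factorial : ℂ)⁻¹) := by
    have : ((n : Ch) + 1) = C ((n : ℂ) + 1) := by simp
    rw [this, ← C_mul, Nat.factorial_succ]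
    congr 1
    push_cast
    field_simp
  rw [e2, e1] at h
  exact h

theorem eval_zero_divFF_succ (n : ℕ) : (divFF (n + 1)).eval 0 = 0 := by
  rw [divFF, eval_smul, fallingFactorial, eval_prod, Finset.prod_range_succ']
  simp

theorem indefSum_divFF (n : ℕ) : indefSum (divFF n) = divFF (n + 1) :=
  indefSum_unique (isIndefiniteSum_divFF n) (eval_zero_divFF_succ n)

section Algebra

variable {R : Type*} [Ring R] [Algebra Ch R]

/-- Positive integers are invertible in `ℂ[ħ]`, so identities between divided falling factorials can
be proved by comparing `(n + 1)`-multiples through `succ_smul_dff`. -/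
theorem succ_smul_cancel {M : Type*} [AddCommGroup M] [Module Ch M] (n : ℕ) {u v : M}
    (h : (n + 1) • u = (n + 1) • v) : u = v := by
  have hn : (C ((n + 1 : ℂ)⁻¹) : Ch) * ((n : Ch) + 1) = 1 := by
    have : ((n : Ch) + 1) = C ((n : ℂ) + 1) := by simp
    rw [this, ← C_mul, inv_mul_cancel₀ (Nat.cast_add_one_ne_zero n), C_1]
  have key (w : M) : (C ((n + 1 : ℂ)⁻¹) : Ch) • ((n + 1) • w) = w := by
    rw [← Nat.cast_smul_eq_nsmul Ch, smul_smul]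
    push_cast
    rw [hn, one_smul]
  rw [← key u, h, key]

/-- The value of the divided falling factorial at an element of a `ℂ[ħ]`-algebra. -/
def dff (x : R) (n : ℕ) : R := aeval x (divFF n)

theorem dff_zero (x : R) : dff x 0 = 1 := by simp [dff, divFF_zero]

theorem succ_smul_dff (x : R) (n : ℕ) :
    (n + 1) • dff x (n + 1) = (x - n • hbar • (1 : R)) * dff x n := by
  have h := congrArg (aeval x) (succ_smul_divFF n)
  rw [map_nsmul, map_mul, map_sub, aeval_X, aeval_C] at h
  rw [dff, h, dff, map_mul, map_natCast, ← Algebra.algebraMap_eq_smul_one, nsmul_eq_mul]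

theorem dff_zero_succ (n : ℕ) : dff (0 : R) (n + 1) = 0 := by
  have : dff (0 : R) (n + 1) = algebraMap Ch R ((divFF (n + 1)).eval 0) := by
    rw [dff, ← coeff_zero_eq_aeval_zero', coeff_zero_eq_eval_zero]
  rw [this, eval_zero_divFF_succ, map_zero]

theorem Commute.dff_right {x y : R} (h : Commute x y) (n : ℕ) : Commute x (dff y n) := by
  refine Polynomial.induction_on (motive := fun p => Commute x (aeval y p)) (divFF n) ?_ ?_ ?_
  · intro r
    rw [aeval_C]
    exact (Algebra.commutes r x).symm
  · intro p q hp hq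
    rw [map_add]
    exact hp.add_right hq
  · intro k r _
    rw [map_mul, aeval_C, map_pow, aeval_X]
    exact Commute.mul_right (Algebra.commutes r x).symm (h.pow_right _)

/-- Writing `n + 1 = p + q` on each term distributes the factor over the two indices, as in the
Leibniz rule for divided powers. -/
theorem sum_antidiagonal_succ_smul {M : Type*} [AddCommGroup M] (F : ℕ → ℕ → M) (n : ℕ) :
    (n + 1) • ∑ p ∈ Finset.HasAntidiagonal.antidiagonal (n + 1), F p.1 p.2
      = ∑ p ∈ Finset.HasAntidiagonal.antidiagonal n,
          ((p.1 + 1) • F (p.1 + 1) p.2 + (p.2 + 1) • F p.1 (p.2 + 1)) := by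
  have h1 : (n + 1) • ∑ p ∈ Finset.HasAntidiagonal.antidiagonal (n + 1), F p.1 p.2
      = ∑ p ∈ Finset.HasAntidiagonal.antidiagonal (n + 1), (p.1 • F p.1 p.2)
        + ∑ p ∈ Finset.HasAntidiagonal.antidiagonal (n + 1), (p.2 • F p.1 p.2) := by
    rw [Finset.smul_sum, ← Finset.sum_add_distrib]
    refine Finset.sum_congr rfl fun p hp => ?_
    rw [← Finset.HasAntidiagonal.mem_antidiagonal.mp hp, add_smul]
  rw [h1, Finset.sum_add_distrib, Finset.Nat.sum_antidiagonal_succ,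
    Finset.Nat.sum_antidiagonal_succ']
  simp

/-- The Chu–Vandermonde identity. -/
theorem dff_add {x y : R} (h : Commute x y) (n : ℕ) :
    dff (x + y) n = ∑ p ∈ Finset.HasAntidiagonal.antidiagonal n, dff x p.1 * dff y p.2 := by
  induction n with
  | zero => simp [dff_zero]
  | succ n ih =>
    refine succ_smul_cancel n ?_
    rw [sum_antidiagonal_succ_smul (fun p q => dff x p * dff y q), succ_smul_dff, ih,
      Finset.mul_sum]
    refine Finset.sum_congr rfl fun p hp => ?_
    rw [← smul_mul_assoc, ← mul_smul_comm, succ_smul_dff, succ_smul_dff,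
      ← Finset.HasAntidiagonal.mem_antidiagonal.mp hp]
    have hc : Commute (dff x p.1) y := (Commute.dff_right h.symm p.1).symm
    rw [sub_mul y, mul_sub (dff x p.1), ← mul_assoc _ y, hc.eq]
    simp only [add_smul, add_mul, sub_mul, smul_mul_assoc, one_mul, mul_smul_comm, mul_assoc]
    abel

/-- This turns the binomial coefficients of `(1 + ħw)^m` into falling factorials, to which
Chu–Vandermonde applies. -/
theorem dff_natCast_smul_hbar (m i : ℕ) :
    dff (m • hbar • (1 : R)) i = m.choose i • hbar ^ i • (1 : R) := by
  induction i with
  | zero => simp [dff_zero]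
  | succ i ih =>
    refine succ_smul_cancel i ?_
    rw [succ_smul_dff, ih]
    have h : ((m : Ch) - i) * (m.choose i : Ch) = (i + 1) * (m.choose (i + 1) : Ch) := by
      have h := congrArg (Nat.cast : ℕ → Ch) (Nat.choose_succ_right_eq m i)
      rcases le_or_gt i m with him | him
      · push_cast [Nat.cast_sub him] at h
        linear_combination -h
      · rw [Nat.choose_eq_zero_of_lt him, Nat.choose_eq_zero_of_lt (him.trans i.lt_succ_self)]
        simp
    have h' := congrArg (fun r : Ch => algebraMap Ch R (r * hbar ^ (i + 1))) h
    simp only [← Nat.cast_smul_eq_nsmul Ch]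
    simp only [Algebra.smul_def (_ : Ch) (_ : R), mul_one]
    simp only [← map_mul, ← map_sub]
    convert h' using 2
    · ring
    · push_cast; ring

theorem dff_map {R' : Type*} [Ring R'] [Algebra Ch R'] (f : R →ₐ[Ch] R') (x : R) (n : ℕ) :
    f (dff x n) = dff (f x) n := by
  rw [dff, dff, aeval_algHom_apply]

end Algebra

/-! ### Locality -/

section Locality

variable {U : Type*} [AddCommGroup U]

/-- Multiplication by `z - w` as an additive endomorphism of the two-variable distributions. -/
def zw (U : Type*) [AddCommGroup U] : Module.End ℤ (ℤ → ℤ → U) where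
  toFun f := Dist₂.mulZSubW f
  map_add' f g := by
    ext m n
    simp only [Dist₂.mulZSubW, Pi.add_apply]
    abel
  map_smul' r f := by
    ext m n
    simp only [Dist₂.mulZSubW, Pi.smul_apply, smul_sub, RingHom.id_apply]

theorem zw_apply (f : ℤ → ℤ → U) (m n : ℤ) : zw U f m n = f (m + 1) n - f m (n + 1) := rfl

theorem mulZSubW_iterate (N : ℕ) (f : ℤ → ℤ → U) : Dist₂.mulZSubW^[N] f = (zw U ^ N) f := by
  rw [Module.End.coe_pow]
  rfl

theorem zw_pow_succ (N : ℕ) (f : ℤ → ℤ → U) : (zw U ^ (N + 1)) f = (zw U ^ N) (zw U f) := by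
  rw [pow_succ, Module.End.mul_apply]

theorem zw_pow_succ' (N : ℕ) (f : ℤ → ℤ → U) : (zw U ^ (N + 1)) f = zw U ((zw U ^ N) f) := by
  rw [pow_succ', Module.End.mul_apply]

theorem pow_apply_eq_zero_of_le {M : Type*} [AddCommGroup M] {S : Module.End ℤ M} {N N' : ℕ}
    (h : N ≤ N') {f : M} (hf : (S ^ N) f = 0) : (S ^ N') f = 0 := by
  obtain ⟨k, rfl⟩ := Nat.exists_eq_add_of_le h
  rw [add_comm, pow_add, Module.End.mul_apply, hf, map_zero]

/-- A two-variable distribution killed by a power of `z - w`. -/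
def IsLocal (f : ℤ → ℤ → U) : Prop := ∃ N : ℕ, (zw U ^ N) f = 0

theorem IsLocal.zero : IsLocal (0 : ℤ → ℤ → U) := ⟨0, rfl⟩

theorem IsLocal.add {f g : ℤ → ℤ → U} (hf : IsLocal f) (hg : IsLocal g) : IsLocal (f + g) := by
  obtain ⟨N, hN⟩ := hf
  obtain ⟨M, hM⟩ := hg
  refine ⟨max N M, ?_⟩
  rw [map_add, pow_apply_eq_zero_of_le (le_max_left N M) hN,
    pow_apply_eq_zero_of_le (le_max_right N M) hM, add_zero]

/-- An additive map commuting with the multiplication by `z - w` preserves locality. -/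
theorem zw_pow_map {W : Type*} [AddCommGroup W] (F : (ℤ → ℤ → U) →+ (ℤ → ℤ → W))
    (hF : ∀ f, zw W (F f) = F (zw U f)) (N : ℕ) (f : ℤ → ℤ → U) :
    (zw W ^ N) (F f) = F ((zw U ^ N) f) := by
  induction N generalizing f with
  | zero => rfl
  | succ N ih => rw [zw_pow_succ, hF, ih, zw_pow_succ]

theorem IsLocal.map {W : Type*} [AddCommGroup W] {f : ℤ → ℤ → U} (hf : IsLocal f)
    (F : (ℤ → ℤ → U) →+ (ℤ → ℤ → W)) (hF : ∀ f, zw W (F f) = F (zw U f)) : IsLocal (F f) := by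
  obtain ⟨N, hN⟩ := hf
  exact ⟨N, by rw [zw_pow_map F hF, hN, map_zero]⟩

/-- Applying an additive map to the coefficients. -/
def mapDist₂ {W : Type*} [AddCommGroup W] (φ : U →+ W) : (ℤ → ℤ → U) →+ (ℤ → ℤ → W) where
  toFun f := fun m n => φ (f m n)
  map_zero' := by ext; simp
  map_add' f g := by ext; simp

theorem zw_mapDist₂ {W : Type*} [AddCommGroup W] (φ : U →+ W) (f : ℤ → ℤ → U) :
    zw W (mapDist₂ φ f) = mapDist₂ φ (zw U f) := by
  ext m n
  simp [zw_apply, mapDist₂]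

theorem IsLocal.mapCoeff {W : Type*} [AddCommGroup W] {f : ℤ → ℤ → U} (hf : IsLocal f)
    (φ : U →+ W) : IsLocal (fun m n => φ (f m n)) :=
  hf.map (mapDist₂ φ) (zw_mapDist₂ φ)

/-- Shift of both indices. -/
def shift₂ (U : Type*) [AddCommGroup U] (i j : ℤ) : (ℤ → ℤ → U) →+ (ℤ → ℤ → U) where
  toFun f := fun m n => f (m + i) (n + j)
  map_zero' := rfl
  map_add' _ _ := rfl

theorem IsLocal.shift {f : ℤ → ℤ → U} (hf : IsLocal f) (i j : ℤ) :
    IsLocal (fun m n => f (m + i) (n + j)) := by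
  refine hf.map (shift₂ U i j) fun f => ?_
  ext m n
  simp [zw_apply, shift₂, add_right_comm]

theorem IsLocal.neg {f : ℤ → ℤ → U} (hf : IsLocal f) : IsLocal (-f) := by
  obtain ⟨N, hN⟩ := hf
  exact ⟨N, by rw [map_neg, hN, neg_zero]⟩

/-- The derivative in the first variable preserves locality. -/
theorem IsLocal.deriv {f : ℤ → ℤ → U} (hf : IsLocal f) :
    IsLocal (fun m n => m • f (m - 1) n) := by
  obtain ⟨N, hN⟩ := hf
  induction N generalizing f with
  | zero =>
    have : f = 0 := hN
    subst this
    exact ⟨0, by ext; simp⟩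
  | succ N ih =>
    have h1 : IsLocal (zw U (fun m n => m • f (m - 1) n)) := by
      -- Leibniz rule: multiplication by `z - w` and the derivative commute up to the distribution
      -- itself, which is local.
      have e : zw U (fun m n => m • f (m - 1) n) = (fun m n => m • zw U f (m - 1) n) + f := by
        ext m n
        simp only [zw_apply, Pi.add_apply, add_sub_cancel_right, sub_add_cancel, smul_sub,
          add_smul, one_smul]
        abel
      rw [e]
      exact (ih (by rw [← zw_pow_succ]; exact hN)).add ⟨N + 1, hN⟩
    obtain ⟨M, hM⟩ := h1
    exact ⟨M + 1, by rw [zw_pow_succ, hM]⟩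

/-- Exchanging the two variables preserves locality. -/
theorem IsLocal.swap {f : ℤ → ℤ → U} (hf : IsLocal f) : IsLocal (fun m n => f n m) := by
  obtain ⟨N, hN⟩ := hf
  induction N generalizing f with
  | zero => exact ⟨0, by ext m n; exact congrFun (congrFun hN n) m⟩
  | succ N ih =>
    obtain ⟨M, hM⟩ := (ih (f := zw U f) (by rw [← zw_pow_succ]; exact hN)).neg
    refine ⟨M + 1, ?_⟩
    rw [zw_pow_succ, ← hM]
    congr 1
    ext m n
    simp [zw_apply]

/-- The recursive form of the expansion of a local distribution. -/
theorem eq_sum_choose_of_local {N : ℕ} {f : ℤ → ℤ → U} (hf : (zw U ^ N) f = 0) (m : ℕ) (n : ℤ) :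
    f m n = ∑ j ∈ Finset.range N, m.choose j • (zw U ^ j) f 0 (m + n - j) := by
  induction m generalizing N f n with
  | zero =>
    cases N with
    | zero =>
      have : f = 0 := hf
      simp [this]
    | succ N => simp [Finset.sum_range_succ']
  | succ m ih =>
    -- From `z = w + (z - w)`; the two resulting expansions combine by Pascal's rule.
    have h1 : f ((m + 1 : ℕ) : ℤ) n = f m (n + 1) + zw U f m n := by
      rw [zw_apply]; push_cast; abel
    cases N with
    | zero =>
      have : f = 0 := hf
      simp [this]
    | succ N =>
      rw [h1, ih hf, ih (N := N) (f := zw U f) (by rw [← zw_pow_succ]; exact hf),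
        Finset.sum_range_succ', Finset.sum_range_succ', add_right_comm, ← Finset.sum_add_distrib]
      simp only [Nat.choose_succ_succ, add_smul, Nat.choose_zero_right, ← zw_pow_succ]
      congr 1
      · refine Finset.sum_congr rfl fun j _ => ?_
        rw [add_comm]
        congr 3 <;> push_cast <;> ring_nf
      · congr 2; push_cast; ring_nf

/-- The expansion of a local distribution at the index `-1`. -/
theorem eq_sum_neg_one_of_local {N : ℕ} {f : ℤ → ℤ → U} (hf : (zw U ^ N) f = 0) (n : ℤ) :
    f (-1) n = ∑ j ∈ Finset.range N, (-1 : ℤ) ^ j • (zw U ^ j) f 0 (n - 1 - j) := by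
  induction N generalizing f n with
  | zero =>
    have : f = 0 := hf
    simp [this]
  | succ N ih =>
    have h1 : f (-1) n = f 0 (n - 1) - zw U f (-1) (n - 1) := by
      rw [zw_apply]; simp
    rw [h1, ih (f := zw U f) (by rw [← zw_pow_succ]; exact hf), Finset.sum_range_succ',
      sub_eq_add_neg, ← Finset.sum_neg_distrib, add_comm]
    simp only [← zw_pow_succ]
    congr 1
    · refine Finset.sum_congr rfl fun j _ => ?_
      rw [pow_succ (-1 : ℤ) j, mul_neg_one, neg_smul]
      congr 3; push_cast; ring_nf
    · simp

/-- A local distribution, regular in the second variable, vanishes at zero of that variable. -/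
theorem IsLocal.apply_neg_one_eq_zero {f : ℤ → ℤ → U} (hf : IsLocal f)
    (h0 : ∀ m n : ℤ, 0 ≤ n → f m n = 0) (m : ℤ) : f m (-1) = 0 := by
  obtain ⟨N, hN⟩ := hf
  -- At `w = 0`, for a series regular in `w`, multiplication by `z - w` is multiplication by `z`,
  -- which is invertible.
  have h (M : ℕ) (m : ℤ) : (∀ n : ℤ, 0 ≤ n → (zw U ^ M) f m n = 0) ∧
      (zw U ^ M) f m (-1) = f (m + M) (-1) := by
    induction M generalizing m with
    | zero => exact ⟨h0 m, by simp⟩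
    | succ M ih =>
      rw [zw_pow_succ']
      refine ⟨fun n hn => ?_, ?_⟩
      · rw [zw_apply, (ih _).1 n hn, (ih _).1 _ (by omega), sub_zero]
      · rw [zw_apply, (ih _).1 (-1 + 1) (by omega), (ih _).2, sub_zero]
        push_cast
        ring_nf
  have h3 := (h N (m - N)).2
  rw [hN, sub_add_cancel] at h3
  exact h3.symm

/-- The part of a distribution with nonnegative first index. -/
def nonnegPart (f : ℤ → ℤ → U) : ℤ → ℤ → U := fun m n => if 0 ≤ m then f m n else 0

/-- The distribution `e(w)`, constant in `z`. -/
def constFst (e : ℤ → U) : ℤ → ℤ → U := fun m n => if m = -1 then e n else 0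

/-- Truncation in `z` fails to commute with `z - w` only at the boundary `m = -1`, where the residue
`f 0` leaks in as a term constant in `z`. -/
theorem zw_nonnegPart (f : ℤ → ℤ → U) :
    zw U (nonnegPart f) = nonnegPart (zw U f) + constFst (f 0) := by
  ext m n
  simp only [zw_apply, nonnegPart, constFst, Pi.add_apply]
  rcases lt_trichotomy m (-1) with h | rfl | h
  · simp [show ¬ 0 ≤ m by omega, show ¬ 0 ≤ m + 1 by omega, h.ne]
  · simp
  · simp [show 0 ≤ m by omega, show 0 ≤ m + 1 by omega, h.ne']

/-- For local `f` and large `N` the first term vanishes, leaving powers of `z - w` times series in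
`w` alone. -/
theorem zw_pow_nonnegPart (N : ℕ) (f : ℤ → ℤ → U) :
    (zw U ^ N) (nonnegPart f) = nonnegPart ((zw U ^ N) f)
      + ∑ j ∈ Finset.range N, (zw U ^ (N - 1 - j)) (constFst ((zw U ^ j) f 0)) := by
  induction N generalizing f with
  | zero => simp
  | succ N ih =>
    rw [zw_pow_succ, zw_nonnegPart, map_add, ih, Finset.sum_range_succ', add_assoc]
    simp only [← zw_pow_succ]
    congr 2
    refine Finset.sum_congr rfl fun j _ => ?_
    congr 2
    omega

end Locality

/-! ### Dong's lemma -/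

section Dong

/-- Every term of the binomial expansion contains `P` or `Q` to a power at least `N`. -/
theorem pow_apply_eq_zero_of_commute {M : Type*} [AddCommGroup M] {P Q : Module.End ℤ M}
    (h : Commute P Q) {N : ℕ} {F : M} (hP : (P ^ N) F = 0) (hQ : (Q ^ N) F = 0) :
    ((P + Q) ^ (N + N)) F = 0 := by
  rw [h.add_pow, LinearMap.sum_apply]
  refine Finset.sum_eq_zero fun i _ => ?_
  rcases le_or_gt N i with hi | hi
  · rw [(h.pow_pow i _).eq, ← nsmul_eq_mul', LinearMap.smul_apply,
      Module.End.mul_apply, pow_apply_eq_zero_of_le hi hP, map_zero, smul_zero]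
  · rw [← nsmul_eq_mul', LinearMap.smul_apply, Module.End.mul_apply,
      pow_apply_eq_zero_of_le (by omega) hQ, map_zero, smul_zero]

theorem Commute.pow_apply {M : Type*} [AddCommGroup M] {P Q : Module.End ℤ M} (h : Commute P Q)
    (a b : ℕ) (F : M) : (P ^ a) ((Q ^ b) F) = (Q ^ b) ((P ^ a) F) := by
  rw [← Module.End.mul_apply, (h.pow_pow a b).eq, Module.End.mul_apply]

/-- The algebra of Dong's lemma, with `Q = z - w`, `R = w - x` and `R + Q = z - x`. The vector `R^N
F` is killed by `(R + Q)^N`, since `R^N` removes `F₁`, and also by `Q^N`. Hence `R = (R + Q) - Q`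
kills it to the power `2N`. -/
theorem pow_apply_eq_zero_of_add {M : Type*} [AddCommGroup M] {Q R : Module.End ℤ M}
    (h : Commute R Q) {N : ℕ} {F F₁ F₂ : M} (hF : F = F₁ + F₂) (hQ : (Q ^ N) F = 0)
    (h₁ : (R ^ N) F₁ = 0) (h₂ : ((R + Q) ^ N) F₂ = 0) : (R ^ (N + N + N)) F = 0 := by
  have hP : Commute (R + Q) R := (Commute.refl R).add_left h.symm
  have hPQ : Commute (R + Q) Q := h.add_left (Commute.refl Q)
  have e : R = (R + Q) + -Q := by abel
  have key := pow_apply_eq_zero_of_commute (P := R + Q) (Q := -Q) hPQ.neg_right (N := N)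
    (F := (R ^ N) F) (by rw [Commute.pow_apply hP, hF, map_add, h₂, add_zero,
      ← Commute.pow_apply hP, h₁, map_zero])
    (by rw [neg_pow, Module.End.mul_apply, Commute.pow_apply h.symm, hQ, map_zero, map_zero])
  rw [← e] at key
  rw [pow_add, Module.End.mul_apply, key]

variable {U : Type*}

/-- Multiplication by `w - x` on three-variable distributions in `z`, `w`, `x`. -/
def wx (U : Type*) [AddCommGroup U] : Module.End ℤ (ℤ → ℤ → ℤ → U) where
  toFun G := fun l => zw U (G l)
  map_add' F G := by ext; simp
  map_smul' r F := by ext; simp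

variable [AddCommGroup U]

theorem wx_pow (N : ℕ) (G : ℤ → ℤ → ℤ → U) (l : ℤ) :
    (wx U ^ N) G l = (zw U ^ N) (G l) := by
  induction N generalizing G with
  | zero => rfl
  | succ N ih =>
    rw [pow_succ, Module.End.mul_apply, ih, zw_pow_succ]
    rfl

theorem zw_pow_apply (N : ℕ) (G : ℤ → ℤ → ℤ → U) (l m n : ℤ) :
    (zw (ℤ → U) ^ N) G l m n = (zw U ^ N) (fun l m => G l m n) l m := by
  induction N generalizing G with
  | zero => rfl
  | succ N ih =>
    rw [zw_pow_succ, ih, zw_pow_succ]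
    rfl

theorem wx_add_zw_pow (N : ℕ) (G : ℤ → ℤ → ℤ → U) (l m n : ℤ) :
    ((wx U + zw (ℤ → U)) ^ N) G l m n = (zw U ^ N) (fun l n => G l m n) l n := by
  induction N generalizing G with
  | zero => rfl
  | succ N ih =>
    rw [pow_succ, Module.End.mul_apply, ih, zw_pow_succ]
    have e : (fun l n => ((wx U + zw (ℤ → U)) G) l m n) = zw U (fun l n => G l m n) := by
      ext l n
      simp [wx, zw_apply]
    rw [e]

theorem commute_wx_zw : Commute (wx U) (zw (ℤ → U)) := by
  refine LinearMap.ext fun G => ?_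
  ext l m n
  simp [wx, zw_apply]
  abel

theorem comm_swap {R : Type*} [Ring R] (A B : ℤ → R) :
    Dist.comm B A = fun m n => -(Dist.comm A B n m) := by
  ext m n
  simp [Dist.comm]

theorem IsLocal.comm_symm {R : Type*} [Ring R] {A B : ℤ → R} (h : IsLocal (Dist.comm A B)) :
    IsLocal (Dist.comm B A) := by
  rw [comm_swap]
  exact h.swap.neg

/-- Dong's lemma for the products with nonnegative index. -/
theorem IsLocal.comm_product {R : Type*} [Ring R] {A B D : ℤ → R} (hAB : IsLocal (Dist.comm A B))
    (hAD : IsLocal (Dist.comm A D)) (hBD : IsLocal (Dist.comm B D)) (j : ℕ) :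
    IsLocal (Dist.comm ((zw R ^ j) (Dist.comm A B) 0) D) := by
  obtain ⟨N₁, h₁⟩ := hAB
  obtain ⟨N₂, h₂⟩ := hAD
  obtain ⟨N₃, h₃⟩ := hBD
  obtain ⟨N, hN₁, hN₂, hN₃⟩ : ∃ N, N₁ ≤ N ∧ N₂ ≤ N ∧ N₃ ≤ N :=
    ⟨N₁ + N₂ + N₃, by omega, by omega, by omega⟩
  replace h₁ := pow_apply_eq_zero_of_le hN₁ h₁
  replace h₂ := pow_apply_eq_zero_of_le hN₂ h₂
  replace h₃ := pow_apply_eq_zero_of_le hN₃ h₃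
  let ad (x : R) : R →+ R := AddMonoidHom.mulRight x - AddMonoidHom.mulLeft x
  have had (x y : R) : ad x y = y * x - x * y := rfl
  have hmap (x : R) (M : ℕ) (f : ℤ → ℤ → R) (m n : ℤ) :
      (zw R ^ M) (fun m n => ad x (f m n)) m n = ad x ((zw R ^ M) f m n) :=
    congrFun (congrFun (zw_pow_map (mapDist₂ (ad x)) (zw_mapDist₂ _) M f) m) n
  let F : ℤ → ℤ → ℤ → R := fun l m n => ad (D n) (Dist.comm A B l m)
  let F₁ : ℤ → ℤ → ℤ → R := fun l m n => -ad (A l) (Dist.comm B D m n)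
  let F₂ : ℤ → ℤ → ℤ → R := fun l m n => ad (B m) (Dist.comm A D l n)
  -- Jacobi identity for the triple commutator: each summand is killed by a power of one difference
  -- of variables.
  have hF : F = F₁ + F₂ := by
    ext l m n
    simp only [F, F₁, F₂, had, Dist.comm, Pi.add_apply]
    noncomm_ring
  have key := pow_apply_eq_zero_of_add (commute_wx_zw (U := R)) (N := N) hF
    (by
      ext l m n
      rw [zw_pow_apply, hmap, h₁]
      simp)
    (by
      have e : F₁ = -fun l m n => ad (A l) (Dist.comm B D m n) := rfl
      rw [e, map_neg, neg_eq_zero]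
      ext l m n
      rw [wx_pow, hmap, h₃]
      simp)
    (by
      ext l m n
      rw [wx_add_zw_pow, hmap, h₂]
      simp)
  refine ⟨N + N + N, ?_⟩
  have e : Dist.comm ((zw R ^ j) (Dist.comm A B) 0) D = (zw (ℤ → R) ^ j) F 0 := by
    ext m n
    rw [zw_pow_apply, hmap]
    rfl
  -- The residue in `z` and the factor `(z - w)^j` both commute with `w - x`.
  rw [e, ← wx_pow, Commute.pow_apply commute_wx_zw, key, map_zero]
  rfl

end Dong

/-! ### Translation covariance -/

section Covariance

variable {V : Type*} [AddCommGroup V] [Module Ch V]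

/-- The covariance `[T, A(w)] = ((1 + ħ w) ∂_w - k ħ) A(w)`. -/
def Cov (T : Module.End Ch V) (k : ℤ) (A : ℤ → Module.End Ch V) : Prop :=
  ∀ n, T * A n - A n * T = -(n • A (n - 1)) - (n + 1 + k) • hbar • A n

/-- The covariance `[T, f(z, w)] = ((1 + ħ z) ∂_z + (1 + ħ w) ∂_w - k ħ) f(z, w)`. -/
def Cov₂ (T : Module.End Ch V) (k : ℤ) (f : ℤ → ℤ → Module.End Ch V) : Prop :=
  ∀ m n, T * f m n - f m n * T = -(m • f (m - 1) n) - (m + 1) • hbar • f m n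
    - n • f m (n - 1) - (n + 1 + k) • hbar • f m n

variable {T : Module.End Ch V}

theorem Cov.sub {k : ℤ} {A B : ℤ → Module.End Ch V} (hA : Cov T k A) (hB : Cov T k B) :
    Cov T k (A - B) := by
  intro n
  have e : T * (A - B) n - (A - B) n * T = (T * A n - A n * T) - (T * B n - B n * T) := by
    simp only [Pi.sub_apply, mul_sub, sub_mul]
    abel
  rw [e, hA, hB]
  simp only [Pi.sub_apply]
  module

theorem Cov.comm {A B : ℤ → Module.End Ch V} (hA : Cov T 0 A) (hB : Cov T 0 B) :
    Cov₂ T 0 (Dist.comm A B) := by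
  intro m n
  have e : T * Dist.comm A B m n - Dist.comm A B m n * T
      = (T * A m - A m * T) * B n - B n * (T * A m - A m * T)
        + (A m * (T * B n - B n * T) - (T * B n - B n * T) * A m) := by
    simp only [Dist.comm]
    noncomm_ring
  rw [e, hA, hB]
  simp only [Dist.comm, mul_sub, sub_mul, mul_neg, neg_mul, smul_mul_assoc, mul_smul_comm]
  module

/-- The derivation `(1+ħz)∂_z + (1+ħw)∂_w` multiplies `z - w` by `ħ`, so the weight rises by one. -/
theorem Cov₂.zw {k : ℤ} {f : ℤ → ℤ → Module.End Ch V} (hf : Cov₂ T k f) :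
    Cov₂ T (k + 1) (zw (Module.End Ch V) f) := by
  intro m n
  have e : T * HbarVA.zw (Module.End Ch V) f m n - HbarVA.zw (Module.End Ch V) f m n * T
      = (T * f (m + 1) n - f (m + 1) n * T) - (T * f m (n + 1) - f m (n + 1) * T) := by
    simp only [zw_apply]
    noncomm_ring
  rw [e, hf, hf]
  simp only [zw_apply, add_sub_cancel_right, sub_add_cancel]
  module

theorem Cov₂.zw_pow {k : ℤ} {f : ℤ → ℤ → Module.End Ch V} (hf : Cov₂ T k f) (j : ℕ) :
    Cov₂ T (k + j) ((HbarVA.zw (Module.End Ch V) ^ j) f) := by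
  induction j with
  | zero => simpa using hf
  | succ j ih =>
    rw [zw_pow_succ', Nat.cast_succ, ← add_assoc]
    exact ih.zw

/-- Integration by parts: the residue of `(1+ħz)∂_z f` is `-ħ` times that of `f`. -/
theorem Cov₂.residue {k : ℤ} {f : ℤ → ℤ → Module.End Ch V} (hf : Cov₂ T k f) :
    Cov T (k + 1) (f 0) := by
  intro n
  rw [hf]
  module

/-- Multiplication by `1 + ħ w`. -/
def mulOneAdd (V : Type*) [AddCommGroup V] [Module Ch V] :
    Module.End Ch (ℤ → Module.End Ch V) :=
  1 + hbar • LinearMap.funLeft Ch _ (fun n : ℤ => n + 1)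

theorem mulOneAdd_apply (A : ℤ → Module.End Ch V) (n : ℤ) :
    mulOneAdd V A n = A n + hbar • A (n + 1) := rfl

theorem mulOneAdd_pow_apply (k : ℕ) (A : ℤ → Module.End Ch V) (n : ℤ) :
    (mulOneAdd V ^ k) A n
      = ∑ i ∈ Finset.range (k + 1), k.choose i • hbar ^ i • A (n + i) := by
  have hs (i : ℕ) (A : ℤ → Module.End Ch V) :
      (LinearMap.funLeft Ch (Module.End Ch V) (fun n : ℤ => n + 1) ^ i) A n = A (n + i) := by
    induction i generalizing A with
    | zero => simp
    | succ i ih =>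
      rw [pow_succ, Module.End.mul_apply, ih, LinearMap.funLeft_apply]
      push_cast
      rw [add_assoc]
  rw [mulOneAdd, add_comm, (Commute.one_right _).add_pow, LinearMap.sum_apply, Finset.sum_apply]
  refine Finset.sum_congr rfl fun i _ => ?_
  rw [one_pow, mul_one, ← nsmul_eq_mul', LinearMap.smul_apply, _root_.smul_pow, LinearMap.smul_apply,
    Pi.smul_apply, Pi.smul_apply, hs]

/-- The derivation `(1+ħw)∂_w` multiplies `1 + ħw` by `ħ`. -/
theorem Cov.mulOneAdd {k : ℤ} {A : ℤ → Module.End Ch V} (hA : Cov T k A) :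
    Cov T (k + 1) (mulOneAdd V A) := by
  intro n
  have e : T * HbarVA.mulOneAdd V A n - HbarVA.mulOneAdd V A n * T
      = (T * A n - A n * T) + hbar • (T * A (n + 1) - A (n + 1) * T) := by
    simp only [mulOneAdd_apply, mul_add, add_mul, smul_mul_assoc, mul_smul_comm, smul_sub]
    abel
  rw [e, hA, hA]
  simp only [mulOneAdd_apply, add_sub_cancel_right, sub_add_cancel]
  module

theorem Cov.mulOneAdd_pow {A : ℤ → Module.End Ch V} (hA : Cov T 0 A) (k : ℕ) :
    Cov T k ((HbarVA.mulOneAdd V ^ k) A) := by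
  induction k with
  | zero => simpa using hA
  | succ k ih =>
    rw [pow_succ', Module.End.mul_apply]
    exact_mod_cast ih.mulOneAdd

theorem IsLocal.comm_mulOneAdd_pow {A B : ℤ → Module.End Ch V} (h : IsLocal (Dist.comm A B))
    (k : ℕ) : IsLocal (Dist.comm ((mulOneAdd V ^ k) A) B) := by
  induction k with
  | zero => simpa using h
  | succ k ih =>
    rw [pow_succ', Module.End.mul_apply]
    have e : Dist.comm (mulOneAdd V ((mulOneAdd V ^ k) A)) B = Dist.comm ((mulOneAdd V ^ k) A) B
        + fun m n => DistribSMul.toAddMonoidHom _ hbar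
            (Dist.comm ((mulOneAdd V ^ k) A) B (m + 1) (n + 0)) := by
      ext m n : 2
      simp only [Dist.comm, mulOneAdd_apply, Pi.add_apply, add_mul, mul_add, smul_mul_assoc,
        mul_smul_comm, DistribSMul.toAddMonoidHom_apply, smul_sub, add_zero]
      abel
    rw [e]
    exact ih.add ((ih.shift 1 0).mapCoeff _)

/-- A translation covariant distribution that creates no state from the vacuum. -/
theorem Cov.apply_vac_eq_zero {k : ℤ} {A : ℤ → Module.End Ch V} (hA : Cov T k A) {v : V}
    (hT : T v = 0) (h0 : ∀ n, -1 ≤ n → A n v = 0) (n : ℤ) : A n v = 0 := by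
  -- As `T v = 0`, covariance expresses `(p + 1) A_(-p-2) v` through `A_(-p-1) v`.
  have main (p : ℕ) : A (-p - 1) v = 0 := by
    induction p with
    | zero => exact h0 _ (by simp)
    | succ p ih =>
      have h := congrArg (fun φ : Module.End Ch V => φ v) (hA (-p - 1))
      simp only [LinearMap.sub_apply, Module.End.mul_apply, LinearMap.neg_apply,
        LinearMap.smul_apply, hT, ih, map_zero, smul_zero, sub_zero] at h
      refine succ_smul_cancel p ?_
      rw [smul_zero, ← natCast_zsmul, h, ← neg_smul]
      push_cast
      congr 2 <;> ring_nf
  rcases le_or_gt (-1) n with hn | hn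
  · exact h0 n hn
  · have := main (-n - 1).toNat
    rwa [Int.toNat_of_nonneg (by omega), neg_sub, sub_neg_eq_add, add_comm, add_sub_cancel_right]
      at this

/-- A translation covariant power series is determined by its constant term. -/
theorem eq_dff_of_recursion {u : ℕ → V}
    (hu : ∀ n, (n + 1) • u (n + 1) = T (u n) - n • hbar • u n) (n : ℕ) :
    u n = dff T n (u 0) := by
  induction n with
  | zero => simp [dff_zero]
  | succ n ih =>
    refine succ_smul_cancel n ?_
    rw [← LinearMap.smul_apply, succ_smul_dff, hu, ih, smul_comm n]
    simp

end Covariance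

/-! ### Uniqueness of fields, translation and nonnegative products -/

namespace HVertexAlgebra

variable {V : Type*} [AddCommGroup V] [Module Ch V] (H : HVertexAlgebra V)

theorem isLocal (a b : V) : IsLocal (Dist.comm (H.Y a) (H.Y b)) := by
  obtain ⟨N, _, hN⟩ := H.locality a b
  exact ⟨N, by rw [← mulZSubW_iterate, hN]⟩

theorem T_apply (a : V) : H.T a = H.Y a (-2) H.vac := rfl

theorem star_apply (a b : V) : H.star a b = H.Y a (-1) b := rfl

theorem T_vac : H.T H.vac = 0 := by
  rw [T_apply, H.vac_left, Pi.single_eq_of_ne (by decide), LinearMap.zero_apply]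

theorem cov (a : V) : Cov H.T 0 (H.Y a) := by
  intro n
  have h := congrFun (H.translation a) n
  simp only [Dist.deriv, Dist.mulZ, Pi.add_apply, Pi.smul_apply, add_sub_cancel_right] at h
  rw [T, h]
  module

/-- Since `T` kills the vacuum, covariance becomes the recursion of the divided falling factorials
at `T`, starting from `a`. -/
theorem Y_vac (a : V) (p : ℕ) : H.Y a (-p - 1) H.vac = dff H.T p a := by
  have h := eq_dff_of_recursion (T := H.T) (u := fun p : ℕ => H.Y a (-p - 1) H.vac) ?_ p
  · simpa [H.vac_right_zero] using h
  · intro n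
    have h := congrArg (fun φ : Module.End Ch V => φ H.vac) (H.cov a (-n - 1))
    simp only [LinearMap.sub_apply, Module.End.mul_apply, LinearMap.neg_apply,
      LinearMap.smul_apply, H.T_vac, map_zero, sub_zero] at h
    rw [h, ← sub_eq_zero]
    have e : (-((n + 1 : ℕ) : ℤ) - 1) = -n - 1 - 1 := by push_cast; ring
    rw [e]
    module

/-- Goddard's uniqueness theorem. -/
theorem eq_zero_of_isLocal {A : ℤ → Module.End Ch V} (hvac : ∀ n, A n H.vac = 0)
    (hloc : ∀ c, IsLocal (Dist.comm A (H.Y c))) : A = 0 := by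
  refine funext fun m => LinearMap.ext fun c => ?_
  -- As `A` kills the vacuum, `[A(z), Y(c,w)]|0⟩ = A(z)Y(c,w)|0⟩`: this is regular in `w`, with
  -- value `A(z)c` at `w = 0`.
  have h1 : IsLocal (fun m n => A m (H.Y c n H.vac)) := by
    have h := (hloc c).mapCoeff (LinearMap.applyₗ (R := Ch) H.vac).toAddMonoidHom
    simpa [Dist.comm, hvac] using h
  have h2 := h1.apply_neg_one_eq_zero (fun m n hn => by rw [H.vac_right c n hn, map_zero]) m
  rwa [H.vac_right_zero] at h2

theorem eq_zero_of_cov {k : ℤ} {A : ℤ → Module.End Ch V} (hA : Cov H.T k A)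
    (hvac : ∀ n, -1 ≤ n → A n H.vac = 0)
    (hloc : ∀ c, IsLocal (Dist.comm A (H.Y c))) : A = 0 :=
  H.eq_zero_of_isLocal (hA.apply_vac_eq_zero H.T_vac hvac) hloc

/-- `Y(T a, w) = (1 + ħ w) ∂_w Y(a, w)`. -/
theorem Y_T (a : V) (n : ℤ) :
    H.Y (H.T a) n = -(n • H.Y a (n - 1)) - (n + 1) • hbar • H.Y a n := by
  let D : ℤ → Module.End Ch V := fun n => H.T * H.Y a n - H.Y a n * H.T
  have hD (n : ℤ) : D n = -(n • H.Y a (n - 1)) - (n + 1 + 0) • hbar • H.Y a n := H.cov a n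
  suffices h : H.Y (H.T a) - D = 0 by
    have h' := congrFun h n
    rw [Pi.sub_apply, Pi.zero_apply, sub_eq_zero, hD, add_zero] at h'
    exact h'
  -- `D = [T, Y(a,w)]` inherits covariance from `Y(a,w)`, and locality because it is built from the
  -- field and its derivative.
  refine H.eq_zero_of_cov (k := 0) ((H.cov _).sub ?_) ?_ ?_
  · intro n
    have e : H.T * D n - D n * H.T = -(n • D (n - 1)) - (n + 1 + 0) • hbar • D n := by
      conv_lhs => rw [hD n]
      simp only [mul_sub, sub_mul, mul_neg, neg_mul, smul_mul_assoc, mul_smul_comm, D]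
      module
    exact e
  · intro n hn
    rcases hn.eq_or_lt with rfl | hn
    · rw [Pi.sub_apply, LinearMap.sub_apply, H.vac_right_zero, hD, T_apply]
      simp
    · rw [Pi.sub_apply, LinearMap.sub_apply, H.vac_right _ _ (by omega)]
      simp [D, H.T_vac, H.vac_right _ n (by omega)]
  · intro c
    have e : Dist.comm (H.Y (H.T a) - D) (H.Y c) = Dist.comm (H.Y (H.T a)) (H.Y c)
        + ((fun m n => m • Dist.comm (H.Y a) (H.Y c) (m - 1) n)
        + fun m n => DistribSMul.toAddMonoidHom _ hbar
            (((m + 1) • Dist.comm (H.Y a) (H.Y c) (m + 1 - 1) (n + 0)))) := by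
      ext m n : 2
      simp only [Dist.comm, Pi.add_apply, Pi.sub_apply, hD, DistribSMul.toAddMonoidHom_apply,
        mul_sub, sub_mul, mul_neg, neg_mul, smul_mul_assoc, mul_smul_comm, add_sub_cancel_right,
        add_zero]
      module
    rw [e]
    exact (H.isLocal _ _).add ((H.isLocal a c).deriv.add
      (((H.isLocal a c).deriv.shift 1 0).mapCoeff _))

/-- `(T)_{j,ħ} / j! a ∗ c = a_{(-j-1)} c`. -/
theorem star_dff (j : ℕ) (a : V) : H.Y (dff H.T j a) (-1) = H.Y a (-j - 1) := by
  induction j generalizing a with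
  | zero => simp [dff_zero]
  | succ j ih =>
    refine succ_smul_cancel j ?_
    have hc : Commute H.T (dff H.T j) := Commute.dff_right (Commute.refl _) j
    have e : (j + 1) • dff H.T (j + 1) a = dff H.T j (H.T a - j • hbar • a) := by
      rw [← LinearMap.smul_apply, succ_smul_dff, sub_mul, hc.eq]
      simp [smul_comm j hbar]
    rw [← Pi.smul_apply, ← map_nsmul, e, ih, map_sub, Pi.sub_apply, Y_T]
    have e' : (-((j + 1 : ℕ) : ℤ) - 1) = -j - 1 - 1 := by push_cast; ring
    simp only [map_nsmul, map_smul, Pi.smul_apply, e']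
    module

/-- The nonnegative products: `(Y(a, w)_{(j)} Y(b, w)) = (1 + ħ w)^{j+1} Y(a_{(j,ħ)} b, w)`. -/
theorem product_eq (a b : V) (j : ℕ) :
    (zw (Module.End Ch V) ^ j) (Dist.comm (H.Y a) (H.Y b)) 0 = (mulOneAdd V ^ (j + 1)) (H.Y (H.Y a j b)) := by
  rw [← sub_eq_zero]
  -- Both sides have weight `j + 1`: on the left `j` from `(z-w)^j` and one from the residue, on the
  -- right one for each factor `1 + ħw`.
  refine H.eq_zero_of_cov (k := (j + 1 : ℕ)) (Cov.sub ?_ ((H.cov _).mulOneAdd_pow _)) ?_ ?_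
  · have := (((H.cov a).comm (H.cov b)).zw_pow j).residue
    rw [zero_add] at this
    exact_mod_cast this
  · have h1 (j : ℕ) (m : ℤ) (hm : 0 ≤ m) :
        (∀ n : ℤ, 0 ≤ n → (zw (Module.End Ch V) ^ j) (Dist.comm (H.Y a) (H.Y b)) m n H.vac = 0)
        ∧ (zw (Module.End Ch V) ^ j) (Dist.comm (H.Y a) (H.Y b)) m (-1) H.vac = H.Y a (m + j) b := by
      induction j generalizing m with
      | zero =>
        refine ⟨fun n hn => ?_, ?_⟩
        · simp [Dist.comm, H.vac_right _ m hm, H.vac_right _ n hn]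
        · simp [Dist.comm, H.vac_right _ m hm, H.vac_right_zero]
      | succ j ih =>
        rw [zw_pow_succ']
        refine ⟨fun n hn => ?_, ?_⟩
        · rw [zw_apply, LinearMap.sub_apply, (ih _ (by omega)).1 n hn,
            (ih _ hm).1 _ (by omega), sub_zero]
        · rw [zw_apply, LinearMap.sub_apply, (ih _ (by omega)).2, (ih _ hm).1 (-1 + 1) (by omega),
            sub_zero]
          push_cast
          ring_nf
    have h2 (k : ℕ) (c : V) : (∀ n : ℤ, 0 ≤ n → (mulOneAdd V ^ k) (H.Y c) n H.vac = 0)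
        ∧ (mulOneAdd V ^ k) (H.Y c) (-1) H.vac = c := by
      induction k with
      | zero => exact ⟨fun n hn => by simp [H.vac_right _ n hn], by simp [H.vac_right_zero]⟩
      | succ k ih =>
        rw [pow_succ', Module.End.mul_apply]
        refine ⟨fun n hn => ?_, ?_⟩
        · rw [mulOneAdd_apply, LinearMap.add_apply, LinearMap.smul_apply, ih.1 n hn,
            ih.1 _ (by omega), smul_zero, add_zero]
        · rw [mulOneAdd_apply, LinearMap.add_apply, LinearMap.smul_apply, ih.2,
            ih.1 (-1 + 1) (by omega), smul_zero, add_zero]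
    intro n hn
    rw [Pi.sub_apply, LinearMap.sub_apply]
    rcases hn.eq_or_lt with rfl | hn
    · rw [(h1 j 0 le_rfl).2, (h2 _ _).2, zero_add, sub_self]
    · rw [(h1 j 0 le_rfl).1 n (by omega), (h2 _ _).1 n (by omega), sub_self]
  · intro c
    have e : Dist.comm ((zw (Module.End Ch V) ^ j) (Dist.comm (H.Y a) (H.Y b)) 0
        - (mulOneAdd V ^ (j + 1)) (H.Y (H.Y a j b))) (H.Y c)
        = Dist.comm ((zw (Module.End Ch V) ^ j) (Dist.comm (H.Y a) (H.Y b)) 0) (H.Y c)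
          + -Dist.comm ((mulOneAdd V ^ (j + 1)) (H.Y (H.Y a j b))) (H.Y c) := by
      ext m n : 2
      simp only [Dist.comm, Pi.add_apply, Pi.sub_apply, Pi.neg_apply]
      noncomm_ring
    rw [e]
    exact ((H.isLocal a b).comm_product (H.isLocal a c) (H.isLocal b c) j).add
      ((H.isLocal _ c).comm_mulOneAdd_pow _).neg

end HVertexAlgebra

/-! ### Products of distributions in the same variable -/

section Convolution

theorem finite_support_of_bounds {M : Type*} [Zero M] {f : ℤ → M} (lo hi : ℤ)
    (h1 : ∀ j < lo, f j = 0) (h2 : ∀ j > hi, f j = 0) : (Function.support f).Finite := by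
  refine (Set.finite_Icc lo hi).subset fun j hj => ⟨?_, ?_⟩
  · by_contra h
    exact hj (h1 j (not_le.mp h))
  · by_contra h
    exact hj (h2 j (not_le.mp h))

variable {W V : Type*} [AddCommGroup W] [AddCommGroup V]

/-- The product `F(z) g(z, w)`. -/
def conv (F : ℤ → W →+ V) (g : ℤ → ℤ → W) : ℤ → ℤ → V :=
  fun m n => ∑ᶠ j : ℤ, F j (g (m - 1 - j) n)

/-- The coefficients of the product `F(z) g(z, w)` are finite sums. -/
def ConvFinite (F : ℤ → W →+ V) (g : ℤ → ℤ → W) : Prop :=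
  ∀ m n, (Function.support fun j : ℤ => F j (g (m - 1 - j) n)).Finite

variable {F : ℤ → W →+ V} {g g' : ℤ → ℤ → W}

theorem ConvFinite.add (h : ConvFinite F g) (h' : ConvFinite F g') : ConvFinite F (g + g') := by
  intro m n
  refine ((h m n).union (h' m n)).subset ?_
  simp only [Pi.add_apply, map_add]
  exact Function.support_add _ _

theorem conv_add (h : ConvFinite F g) (h' : ConvFinite F g') :
    conv F (g + g') = conv F g + conv F g' := by
  ext m n
  simp only [conv, Pi.add_apply, map_add]
  exact finsum_add_distrib (h m n) (h' m n)

theorem conv_zero : conv F 0 = 0 := by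
  ext m n
  simp [conv]

theorem ConvFinite.zero : ConvFinite F 0 := by
  intro m n
  simp

theorem conv_neg : conv F (-g) = -conv F g := by
  ext m n
  simp [conv, finsum_neg_distrib]

theorem zw_eq_shift (g : ℤ → ℤ → W) (m n j : ℤ) :
    zw W g (m - 1 - j) n = g (m + 1 - 1 - j) n - g (m - 1 - j) (n + 1) := by
  rw [zw_apply]
  congr 2
  ring_nf

theorem ConvFinite.zw (h : ConvFinite F g) : ConvFinite F (zw W g) := by
  intro m n
  refine ((h (m + 1) n).union (h m (n + 1))).subset ?_
  simp only [zw_eq_shift, map_sub]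
  exact Function.support_sub _ _

theorem zw_conv (h : ConvFinite F g) : HbarVA.zw V (conv F g) = conv F (HbarVA.zw W g) := by
  ext m n
  simp only [zw_apply (conv F g), conv, zw_eq_shift, map_sub]
  exact (finsum_sub_distrib (h (m + 1) n) (h m (n + 1))).symm

theorem ConvFinite.zw_pow (h : ConvFinite F g) (N : ℕ) : ConvFinite F ((HbarVA.zw W ^ N) g) := by
  induction N with
  | zero => exact h
  | succ N ih => rw [zw_pow_succ']; exact ih.zw

theorem zw_pow_conv (h : ConvFinite F g) (N : ℕ) :
    (HbarVA.zw V ^ N) (conv F g) = conv F ((HbarVA.zw W ^ N) g) := by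
  induction N with
  | zero => rfl
  | succ N ih => rw [zw_pow_succ', ih, zw_conv (h.zw_pow N), ← zw_pow_succ']

theorem ConvFinite.constFst (e : ℤ → W) : ConvFinite F (constFst e) := by
  intro m n
  refine finite_support_of_bounds m m (fun j hj => ?_) (fun j hj => ?_)
  · rw [HbarVA.constFst, if_neg (by omega), map_zero]
  · rw [HbarVA.constFst, if_neg (by omega), map_zero]

theorem conv_constFst (e : ℤ → W) : conv F (constFst e) = fun m n => F m (e n) := by
  ext m n
  rw [conv, finsum_eq_single _ m]
  · rw [constFst, if_pos (by ring)]
  · intro j hj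
    rw [constFst, if_neg (by omega), map_zero]

theorem IsLocal.of_zw_pow {f : ℤ → ℤ → W} (N : ℕ) (h : IsLocal ((HbarVA.zw W ^ N) f)) :
    IsLocal f := by
  obtain ⟨M, hM⟩ := h
  exact ⟨M + N, by rw [pow_add, Module.End.mul_apply, hM]⟩

theorem IsLocal.zw_pow {f : ℤ → ℤ → W} (h : IsLocal f) (N : ℕ) :
    IsLocal ((HbarVA.zw W ^ N) f) := by
  obtain ⟨M, hM⟩ := h
  exact ⟨M, by rw [Commute.pow_apply (Commute.refl _), hM, map_zero]⟩

theorem finsum_reflect {M : Type*} [AddCommMonoid M] (f : ℤ → M) (m : ℤ) :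
    ∑ᶠ j, f j = ∑ᶠ j, f (m - 1 - j) :=
  (finsum_comp_equiv (Equiv.subLeft (m - 1))).symm

theorem finite_support_reflect {M : Type*} [Zero M] {f : ℤ → M} {m : ℤ}
    (h : (Function.support fun j => f (m - 1 - j)).Finite) : (Function.support f).Finite := by
  refine (h.image fun j => m - 1 - j).subset fun j hj => ⟨m - 1 - j, ?_, by ring⟩
  rw [Function.mem_support]
  convert hj using 2
  ring_nf

theorem sum_Ico_neg {M : Type*} [AddCommMonoid M] (f : ℤ → M) (K : ℕ) :
    ∑ j ∈ Finset.Ico (-K : ℤ) K, f j = ∑ j ∈ Finset.range K, (f (-j - 1) + f j) := by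
  induction K with
  | zero => simp
  | succ K ih =>
    have e : Finset.Ico (-((K + 1 : ℕ) : ℤ)) ((K + 1 : ℕ) : ℤ)
        = insert (-K - 1 : ℤ) (insert (K : ℤ) (Finset.Ico (-K : ℤ) K)) := by
      ext j
      simp only [Finset.mem_Ico, Finset.mem_insert]
      omega
    rw [e, Finset.sum_insert (by simp only [Finset.mem_insert, Finset.mem_Ico]; omega),
      Finset.sum_insert (by simp), ih, Finset.sum_range_succ, add_comm (∑ j ∈ _, _), add_assoc]

end Convolution

/-! ### The field of a product is the normally ordered product -/

namespace HVertexAlgebra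

variable {V : Type*} [AddCommGroup V] [Module Ch V] (H : HVertexAlgebra V)

/-- The part of `A(z)` with nonnegative powers of `z`. -/
def creation (A : ℤ → Module.End Ch V) : ℤ → Module.End Ch V := fun j => if j < 0 then A j else 0

/-- The part of `A(z)` with negative powers of `z`. -/
def annihilation (A : ℤ → Module.End Ch V) : ℤ → Module.End Ch V :=
  fun j => if 0 ≤ j then A j else 0

theorem creation_add_annihilation (A : ℤ → Module.End Ch V) (j : ℤ) :
    creation A j = A j - annihilation A j := by
  unfold creation annihilation
  split_ifs <;> first | omega | simp

theorem comm_annihilation (A B : ℤ → Module.End Ch V) :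
    Dist.comm (annihilation A) B = nonnegPart (Dist.comm A B) := by
  ext m n : 2
  simp only [Dist.comm, annihilation, nonnegPart]
  split_ifs <;> simp

theorem comm_creation (A B : ℤ → Module.End Ch V) :
    Dist.comm (creation A) B = Dist.comm A B - nonnegPart (Dist.comm A B) := by
  rw [← comm_annihilation]
  ext m n : 2
  simp only [Dist.comm, creation_add_annihilation, Pi.sub_apply]
  noncomm_ring

/-- The value of the normally ordered product on the vacuum. -/
theorem Y_star_vac (a b : V) (m : ℤ) :
    H.Y (H.star a b) m H.vac
      = ∑ᶠ j : ℤ, creation (H.Y a) j (H.Y b (m - 1 - j) H.vac) := by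
  rcases le_or_gt 0 m with hm | hm
  · rw [H.vac_right _ _ hm, finsum_eq_zero_of_forall_eq_zero]
    intro j
    rcases lt_or_ge j 0 with hj | hj
    · rw [H.vac_right b _ (by omega), map_zero]
    · rw [creation, if_neg (by omega), LinearMap.zero_apply]
  · obtain ⟨p, rfl⟩ : ∃ p : ℕ, m = -p - 1 := ⟨(-m - 1).toNat, by omega⟩
    -- The power series `Y(a,z)_+ Y(b,z)|0⟩`, with `+` the creation part, obeys the recursion of
    -- `Y(a ∗ b, z)|0⟩` and has the same constant term `a ∗ b`.
    let u : ℕ → V := fun n => ∑ q ∈ Finset.HasAntidiagonal.antidiagonal n,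
      H.Y a (-q.1 - 1) (H.Y b (-q.2 - 1) H.vac)
    have hu (n : ℕ) : (n + 1) • u (n + 1) = H.T (u n) - n • hbar • u n := by
      simp only [u]
      rw [sum_antidiagonal_succ_smul
        (fun x y : ℕ => H.Y a (-x - 1) (H.Y b (-y - 1) H.vac)), map_sum, Finset.smul_sum,
        Finset.smul_sum, ← Finset.sum_sub_distrib]
      refine Finset.sum_congr rfl fun q hq => ?_
      rw [← Finset.HasAntidiagonal.mem_antidiagonal.mp hq]
      have hA := congrArg (fun φ : Module.End Ch V => φ (H.Y b (-q.2 - 1) H.vac))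
        (H.cov a (-q.1 - 1))
      have hB := congrArg (fun φ : Module.End Ch V => H.Y a (-q.1 - 1) (φ H.vac))
        (H.cov b (-q.2 - 1))
      simp only [LinearMap.sub_apply, Module.End.mul_apply, LinearMap.neg_apply,
        LinearMap.smul_apply, H.T_vac, map_zero, sub_zero, map_sub, map_neg, map_zsmul,
        map_smul] at hA hB
      rw [sub_eq_iff_eq_add] at hA
      rw [hA, hB]
      have e (x : ℕ) : (-((x + 1 : ℕ) : ℤ) - 1) = -x - 1 - 1 := by push_cast; ring
      rw [e, e]
      module
    rw [H.Y_vac, show H.star a b = u 0 by simp [u, H.star_apply, H.vac_right_zero],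
      ← eq_dff_of_recursion hu]
    rw [finsum_eq_sum_of_support_subset (s := (Finset.HasAntidiagonal.antidiagonal p).image
      fun q => (-q.1 - 1 : ℤ))]
    · rw [Finset.sum_image]
      · refine Finset.sum_congr rfl fun q hq => ?_
        rw [creation, if_pos (by omega), ← Finset.HasAntidiagonal.mem_antidiagonal.mp hq]
        congr 3
        push_cast
        ring_nf
      · intro q hq q' hq' h
        have h1 := Finset.HasAntidiagonal.mem_antidiagonal.mp hq
        have h2 := Finset.HasAntidiagonal.mem_antidiagonal.mp hq'
        have h3 : (-q.1 - 1 : ℤ) = -q'.1 - 1 := h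
        ext <;> omega
    · intro j hj
      rw [Function.mem_support] at hj
      have hj0 : j < 0 := by
        by_contra h
        exact hj (by rw [creation, if_neg h, LinearMap.zero_apply])
      have hj1 : -(p : ℤ) - 1 - 1 - j < 0 := by
        by_contra h
        exact hj (by rw [H.vac_right b _ (not_lt.mp h), map_zero])
      simp only [Finset.coe_image, Set.mem_image, SetLike.mem_coe,
        Finset.HasAntidiagonal.mem_antidiagonal]
      exact ⟨((-j - 1).toNat, (p + j + 1).toNat), by dsimp only; omega, by dsimp only; omega⟩

section NormalOrdering

variable (a b c : V)

/-- Evaluation at the coefficients of `Y(b, z)|0⟩`. -/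
def evalVac : ℤ → Module.End Ch V →+ V :=
  fun i => (LinearMap.applyₗ (R := Ch) (H.Y b i H.vac)).toAddMonoidHom

/-- The difference is `[Y(b,z), P(z,w)]|0⟩`. Up to powers of `z - w`, the summands of `P` are
residues `e(w)`, which by `product_eq` are powers of `1 + ħw` times fields of the algebra, hence
local with `Y(b,z)`. -/
theorem isLocal_conv_sub {N : ℕ} :
    let P := ∑ j ∈ Finset.range N, (zw (Module.End Ch V) ^ (N - 1 - j))
      (constFst ((zw (Module.End Ch V) ^ j) (Dist.comm (H.Y a) (H.Y c)) 0))
    IsLocal (conv (fun i => (H.Y b i).toAddMonoidHom) (fun m n => P m n H.vac)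
      - conv (H.evalVac b) P) := by
  intro P
  let B : ℤ → V →+ V := fun i => (H.Y b i).toAddMonoidHom
  let ev : (ℤ → ℤ → Module.End Ch V) →+ (ℤ → ℤ → V) :=
    mapDist₂ (LinearMap.applyₗ (R := Ch) H.vac).toAddMonoidHom
  -- Finiteness is carried along because `conv` is additive, and commutes with `z - w`, only for
  -- finite sums.
  let good : (ℤ → ℤ → Module.End Ch V) → Prop := fun g =>
    ConvFinite B (ev g) ∧ ConvFinite (H.evalVac b) g
      ∧ IsLocal (conv B (ev g) - conv (H.evalVac b) g)
  suffices h : good P from h.2.2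
  refine Finset.sum_induction _ good ?_ ?_ fun j _ => ?_
  · rintro g g' ⟨h1, h2, h3⟩ ⟨h1', h2', h3'⟩
    refine ⟨by rw [map_add]; exact h1.add h1', h2.add h2', ?_⟩
    rw [map_add, conv_add h1 h1', conv_add h2 h2', add_sub_add_comm]
    exact h3.add h3'
  · refine ⟨by rw [map_zero]; exact ConvFinite.zero, ConvFinite.zero, ?_⟩
    rw [map_zero, conv_zero, conv_zero, sub_zero]
    exact IsLocal.zero
  · set e := (zw (Module.End Ch V) ^ j) (Dist.comm (H.Y a) (H.Y c)) 0 with he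
    have hev : ev (constFst e) = constFst (fun n => e n H.vac) := by
      ext m n
      simp only [ev, mapDist₂, constFst, AddMonoidHom.coe_mk, ZeroHom.coe_mk]
      split_ifs <;> simp
    have h1 : ConvFinite B (ev (constFst e)) := by rw [hev]; exact ConvFinite.constFst _
    have h2 : ConvFinite (H.evalVac b) (constFst e) := ConvFinite.constFst _
    have hzw : ev ((zw (Module.End Ch V) ^ (N - 1 - j)) (constFst e))
        = (zw V ^ (N - 1 - j)) (ev (constFst e)) :=
      (zw_pow_map ev (zw_mapDist₂ _) _ _).symm
    refine ⟨by rw [hzw]; exact h1.zw_pow _, h2.zw_pow _, ?_⟩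
    rw [hzw, ← zw_pow_conv h1, ← zw_pow_conv h2, ← map_sub]
    refine IsLocal.zw_pow ?_ _
    rw [hev, conv_constFst, conv_constFst]
    have hloc : IsLocal (Dist.comm (H.Y b) e) := by
      rw [he, H.product_eq]
      exact ((H.isLocal _ b).comm_mulOneAdd_pow _).comm_symm
    exact hloc.mapCoeff (LinearMap.applyₗ (R := Ch) H.vac).toAddMonoidHom

/-- The normally ordered product `:Y(a, z) Y(b, z):`. -/
def normalOrder (m : ℤ) (v : V) : V :=
  ∑ᶠ j : ℤ, (creation (H.Y a) j (H.Y b (m - 1 - j) v)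
    + H.Y b (m - 1 - j) (annihilation (H.Y a) j v))

/-- Write `A`, `B`, `C` for the fields of `a`, `b`, `c`. On the vacuum the expression is `A_+[B,C] +
B[A_-,C] + [A_+,C]B`. The first term is local because `[B,C]` is; the other two are local only
jointly. -/
theorem isLocal_normalOrder :
    IsLocal (fun m n => H.normalOrder a b m (H.Y c n H.vac)
      - H.Y c n (H.Y (H.star a b) m H.vac)) := by
  let Ap : ℤ → V →+ V := fun j => (creation (H.Y a) j).toAddMonoidHom
  let B : ℤ → V →+ V := fun i => (H.Y b i).toAddMonoidHom
  let ev : (ℤ → ℤ → Module.End Ch V) →+ (ℤ → ℤ → V) :=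
    mapDist₂ (LinearMap.applyₗ (R := Ch) H.vac).toAddMonoidHom
  have hf₁ : ConvFinite Ap (ev (Dist.comm (H.Y b) (H.Y c))) := by
    intro m n
    obtain ⟨K, hK⟩ := H.field b (H.Y c n H.vac)
    refine finite_support_of_bounds (m - 1 - max K 0) 0 (fun j hj => ?_) (fun j hj => ?_)
    · have : Dist.comm (H.Y b) (H.Y c) (m - 1 - j) n H.vac = 0 := by
        simp only [Dist.comm, LinearMap.sub_apply, Module.End.mul_apply]
        rw [hK _ (by omega), H.vac_right b _ (by omega), map_zero, sub_zero]
      exact (congrArg (Ap j) this).trans (map_zero _)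
    · simp [Ap, creation, not_lt.mpr hj.le]
  have hf₂ : ConvFinite (H.evalVac b) (Dist.comm (creation (H.Y a)) (H.Y c)) := by
    intro m n
    refine finite_support_of_bounds (m - 1) 0 (fun j hj => ?_) (fun j hj => ?_)
    · simp [evalVac, Dist.comm, creation, show ¬ m - 1 - j < 0 by omega]
    · simp [evalVac, H.vac_right b j hj.le]
  have hf₃ : ConvFinite B (ev (Dist.comm (annihilation (H.Y a)) (H.Y c))) := by
    intro m n
    obtain ⟨K, hK⟩ := H.field a (H.Y c n H.vac)
    refine finite_support_of_bounds (m - 1 - max K 0) (m - 1) (fun j hj => ?_) (fun j hj => ?_)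
    · have : Dist.comm (annihilation (H.Y a)) (H.Y c) (m - 1 - j) n H.vac = 0 := by
        simp only [Dist.comm, LinearMap.sub_apply, Module.End.mul_apply]
        rw [annihilation, if_pos (by omega), hK _ (by omega), H.vac_right a _ (by omega),
          map_zero, sub_zero]
      exact (congrArg (B j) this).trans (map_zero _)
    · have : Dist.comm (annihilation (H.Y a)) (H.Y c) (m - 1 - j) n H.vac = 0 := by
        simp only [Dist.comm, annihilation]
        rw [if_neg (by omega), zero_mul, mul_zero, sub_zero, LinearMap.zero_apply]
      exact (congrArg (B j) this).trans (map_zero _)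
  have key : (fun m n => H.normalOrder a b m (H.Y c n H.vac)
      - H.Y c n (H.Y (H.star a b) m H.vac))
      = conv Ap (ev (Dist.comm (H.Y b) (H.Y c)))
        + (conv B (ev (Dist.comm (annihilation (H.Y a)) (H.Y c)))
          + conv (H.evalVac b) (Dist.comm (creation (H.Y a)) (H.Y c))) := by
    ext m n
    have hfin : (Function.support fun j : ℤ =>
        creation (H.Y a) j (H.Y b (m - 1 - j) H.vac)).Finite := by
      refine finite_support_of_bounds (m - 1) 0 (fun j hj => ?_) (fun j hj => ?_)
      · rw [H.vac_right b _ (by omega), map_zero]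
      · rw [creation, if_neg (by omega), LinearMap.zero_apply]
    have hfin' : (Function.support fun j : ℤ =>
        (creation (H.Y a) j (H.Y b (m - 1 - j) (H.Y c n H.vac))
          + H.Y b (m - 1 - j) (annihilation (H.Y a) j (H.Y c n H.vac)))).Finite := by
      obtain ⟨K, hK⟩ := H.field a (H.Y c n H.vac)
      obtain ⟨L, hL⟩ := H.field b (H.Y c n H.vac)
      refine finite_support_of_bounds (min (m - 1 - L) (-1)) (max K 0) (fun j hj => ?_)
        (fun j hj => ?_)
      · rw [hL _ (by omega), annihilation, if_neg (by omega)]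
        simp
      · rw [creation, if_neg (by omega), annihilation, if_pos (by omega), hK _ (by omega)]
        simp
    have hC := AddMonoidHom.map_finsum (H.Y c n).toAddMonoidHom hfin
    simp only [LinearMap.toAddMonoidHom_coe] at hC
    rw [Y_star_vac, hC, normalOrder]
    simp only [Pi.add_apply, conv]
    have e₂ := finsum_reflect (fun j => H.evalVac b j
      (Dist.comm (creation (H.Y a)) (H.Y c) (m - 1 - j) n)) m
    have e₃ := finsum_reflect (fun j => B j
      (ev (Dist.comm (annihilation (H.Y a)) (H.Y c)) (m - 1 - j) n)) m
    have s₂ := finite_support_reflect (m := m) (f := fun j => H.evalVac b (m - 1 - j)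
      (Dist.comm (creation (H.Y a)) (H.Y c) (m - 1 - (m - 1 - j)) n))
      (by simpa only [sub_sub_cancel] using hf₂ m n)
    have s₃ := finite_support_reflect (m := m) (f := fun j => B (m - 1 - j)
      (ev (Dist.comm (annihilation (H.Y a)) (H.Y c)) (m - 1 - (m - 1 - j)) n))
      (by simpa only [sub_sub_cancel] using hf₃ m n)
    rw [e₂, e₃, ← finsum_add_distrib s₃ s₂, ← finsum_add_distrib (hf₁ m n)
      ((s₃.union s₂).subset (Function.support_add _ _)), ← finsum_sub_distrib hfin'
      (hfin.subset fun j hj h => hj (by simp [h]))]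
    refine finsum_congr fun j => ?_
    have h0 : annihilation (H.Y a) j H.vac = 0 := by
      unfold annihilation
      split_ifs with h
      · exact H.vac_right a j h
      · rfl
    simp [Ap, B, ev, mapDist₂, evalVac, Dist.comm, h0]
    abel
  rw [key]
  refine IsLocal.add ?_ ?_
  · obtain ⟨N, hN⟩ := H.isLocal b c
    refine ⟨N, ?_⟩
    rw [zw_pow_conv hf₁, zw_pow_map ev (zw_mapDist₂ _), hN, map_zero, conv_zero]
  · obtain ⟨N, hN⟩ := H.isLocal a c
    -- After multiplication by `(z-w)^N` the commutators `[A_-,C]` and `[A_+,C]` become `P` and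
    -- `-P`, leaving `[B,P]|0⟩`.
    refine IsLocal.of_zw_pow N ?_
    rw [map_add, zw_pow_conv hf₂, zw_pow_conv hf₃, zw_pow_map ev (zw_mapDist₂ _),
      comm_creation, comm_annihilation, map_sub, zw_pow_nonnegPart, hN]
    have h0 : nonnegPart (0 : ℤ → ℤ → Module.End Ch V) = 0 := by
      ext m n : 2
      simp [nonnegPart]
    rw [h0, zero_add, zero_sub, conv_neg, ← sub_eq_add_neg]
    exact H.isLocal_conv_sub a b c

/-- Goddard's argument on vectors: the difference of the two sides applied to `Y(c,w)|0⟩` is local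
and regular in `w`, so it vanishes at `w = 0`. -/
theorem Y_star (m : ℤ) : H.Y (H.star a b) m c = H.normalOrder a b m c := by
  have h1 := ((H.isLocal (H.star a b) c).mapCoeff
    (LinearMap.applyₗ (R := Ch) H.vac).toAddMonoidHom).add (H.isLocal_normalOrder a b c).neg
  have h2 := h1.apply_neg_one_eq_zero (fun m n hn => ?_) m
  · simpa [Dist.comm, H.vac_right_zero, sub_eq_zero] using h2
  · simp [Dist.comm, H.vac_right c n hn, normalOrder]

theorem Y_star_apply (m : ℤ) (K : ℕ) (ha : ∀ j : ℕ, K ≤ j → H.Y a j c = 0)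
    (hb : ∀ j : ℕ, K ≤ j → H.Y b (m + j) c = 0) :
    H.Y (H.star a b) m c = ∑ j ∈ Finset.range K,
      (H.Y a (-j - 1) (H.Y b (m + j) c) + H.Y b (m - 1 - j) (H.Y a j c)) := by
  rw [Y_star, normalOrder, finsum_eq_sum_of_support_subset (s := Finset.Ico (-K : ℤ) K),
    sum_Ico_neg]
  · refine Finset.sum_congr rfl fun j _ => ?_
    rw [creation, if_pos (by omega), annihilation, if_neg (by omega), creation,
      if_neg (by omega), annihilation, if_pos (by omega), LinearMap.zero_apply, map_zero,
      LinearMap.zero_apply, add_zero, zero_add]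
    congr 3
    ring_nf
  · intro j hj
    rw [Finset.coe_Ico, Set.mem_Ico]
    by_contra h
    refine hj ?_
    dsimp only
    rcases lt_or_ge j 0 with h0 | h0
    · obtain ⟨i, rfl⟩ : ∃ i : ℕ, j = -i - 1 := ⟨(-j - 1).toNat, by omega⟩
      rw [annihilation, if_neg (by omega), show m - 1 - (-(i : ℤ) - 1) = m + i by ring,
        hb i (by omega)]
      simp
    · obtain ⟨i, rfl⟩ := Int.eq_ofNat_of_zero_le h0
      rw [creation, if_neg (by omega), annihilation, if_pos h0, ha i (by omega)]
      simp

end NormalOrdering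

end HVertexAlgebra

/-! ### Identities for divided falling factorials -/

section Identities

variable {R : Type*} [Ring R] [Algebra Ch R]

theorem dff_X (n : ℕ) : dff (X : Ch[X]) n = divFF n := by
  rw [dff, aeval_X_left_apply]

theorem dff_add_hbar (x : R) (n : ℕ) :
    dff (x + hbar • (1 : R)) (n + 1) = dff x (n + 1) + hbar • dff x n := by
  have h := congrArg (aeval x) (isIndefiniteSum_divFF n)
  rw [map_sub, aeval_comp, map_mul, aeval_C, map_add, aeval_X, aeval_C,
    Algebra.algebraMap_eq_smul_one, smul_one_mul, sub_eq_iff_eq_add] at h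
  rw [dff, dff, dff, h, add_comm]

theorem succ_smul_dff_add_hbar (x : R) (n : ℕ) :
    (n + 1) • dff (x + hbar • (1 : R)) (n + 1) = (x + hbar • (1 : R)) * dff x n := by
  rw [dff_add_hbar, smul_add, succ_smul_dff]
  simp only [sub_mul, add_mul, smul_mul_assoc, one_mul]
  module

/-- Changing the sign of each factor `-x - (i+1)ħ` and reversing their order gives the falling
product from `x + kħ`. -/
theorem dff_neg_sub_hbar (x : R) (k : ℕ) :
    dff (-x - hbar • (1 : R)) k = (-1 : ℤ) ^ k • dff (x + k • hbar • (1 : R)) k := by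
  induction k with
  | zero => simp [dff_zero]
  | succ k ih =>
    refine succ_smul_cancel k ?_
    have e : x + (k + 1) • hbar • (1 : R) = (x + k • hbar • (1 : R)) + hbar • (1 : R) := by module
    rw [succ_smul_dff, ih, smul_comm (k + 1) ((-1 : ℤ) ^ (k + 1)), e, succ_smul_dff_add_hbar, pow_succ, mul_neg_one, neg_smul,
      ← smul_neg, mul_smul_comm, ← neg_mul]
    congr 2
    module

theorem choose_smul_divFF (j p : ℕ) :
    (p + j).choose j • divFF (p + j)
      = divFF j * dff ((X : Ch[X]) - j • hbar • (1 : Ch[X])) p := by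
  induction p with
  | zero => simp [dff_zero]
  | succ p ih =>
    refine succ_smul_cancel p ?_
    have hc : (p + 1) * (p + 1 + j).choose j = (p + j).choose j * (p + j + 1) := by
      have := Nat.add_one_mul_choose_eq (p + j) p
      rw [← Nat.choose_symm_add (a := p + 1) (b := j), ← Nat.choose_symm_add (a := p) (b := j),
        show p + 1 + j = (p + j).succ by omega, mul_comm _ (p + j + 1)]
      rw [mul_comm (p + 1)]
      exact this.symm
    rw [smul_smul, hc, show p + 1 + j = p + j + 1 by omega, ← smul_smul, ← dff_X (p + j + 1),
      succ_smul_dff, dff_X, ← mul_smul_comm, ih, ← mul_smul_comm, succ_smul_dff, mul_left_comm]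
    congr 2
    module

/-- The indefinite sum of `(x)_i / i! · (-x-ħ)_q / q!`. -/
def betaSum : ℕ → ℕ → Ch[X]
  | i, 0 => divFF (i + 1)
  | i, q + 1 => divFF (i + 1) * dff (-X : Ch[X]) (q + 1) + betaSum (i + 1) q

theorem dff_comp (x r : Ch[X]) (n : ℕ) : (dff x n).comp r = dff (x.comp r) n := by
  have h := dff_map (aeval r) x n
  rwa [← comp_eq_aeval, ← comp_eq_aeval] at h

theorem C_hbar_eq : (C hbar : Ch[X]) = hbar • (1 : Ch[X]) := by
  rw [smul_eq_C_mul, mul_one]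

/-- Summation by parts: the difference of `(-x)_{q+1}/(q+1)!` is `-(-x-ħ)_q/q!`, and the remainder
is the same problem at `(i + 1, q)`. -/
theorem isIndefiniteSum_betaSum (i q : ℕ) :
    IsIndefiniteSum (betaSum i q) (dff (-X - hbar • (1 : Ch[X])) q * divFF i) := by
  induction q generalizing i with
  | zero =>
    rw [dff_zero, one_mul]
    exact isIndefiniteSum_divFF i
  | succ q ih =>
    have h1 := dff_add_hbar (-X - hbar • (1 : Ch[X])) q
    rw [sub_add_cancel] at h1
    have h2 := ih (i + 1)
    have h3 := isIndefiniteSum_divFF i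
    unfold IsIndefiniteSum at h2 h3 ⊢
    rw [betaSum, add_comp, mul_comp, dff_comp, neg_comp, X_comp, neg_add',
      C_hbar_eq, h1] at *
    simp only [smul_eq_C_mul] at *
    rw [sub_eq_iff_eq_add] at h2 h3
    rw [h2, h3]
    ring

theorem eval_zero_betaSum (i q : ℕ) : (betaSum i q).eval 0 = 0 := by
  induction q generalizing i with
  | zero => exact eval_zero_divFF_succ i
  | succ q ih => rw [betaSum, eval_add, eval_mul, eval_zero_divFF_succ, zero_mul, ih, add_zero]

theorem indefSum_betaSum (i q : ℕ) :
    indefSum (dff (-X - hbar • (1 : Ch[X])) q * divFF i) = betaSum i q :=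
  indefSum_unique (isIndefiniteSum_betaSum i q) (eval_zero_betaSum i q)

/-- The discrete beta integral. -/
theorem sum_betaSum_mul_divFF (i j : ℕ) :
    ∑ p ∈ Finset.HasAntidiagonal.antidiagonal j, betaSum i p.2 * divFF p.1
      = divFF (i + j + 1) := by
  induction j generalizing i with
  | zero => simp [betaSum, divFF_zero]
  | succ j ih =>
    -- Chu–Vandermonde for `X + (-X) = 0` evaluates the boundary terms of the summation by parts.
    have hv := dff_add (Commute.all (X : Ch[X]) (-X)) (j + 1)
    rw [add_neg_cancel, dff_zero_succ, Finset.Nat.sum_antidiagonal_succ'] at hv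
    rw [Finset.Nat.sum_antidiagonal_succ']
    simp only [betaSum, add_mul, Finset.sum_add_distrib, ih]
    have e : ∑ p ∈ Finset.HasAntidiagonal.antidiagonal j,
        divFF (i + 1) * dff (-X : Ch[X]) (p.2 + 1) * divFF p.1
        = divFF (i + 1) * ∑ p ∈ Finset.HasAntidiagonal.antidiagonal j,
          dff (X : Ch[X]) p.1 * dff (-X : Ch[X]) (p.2 + 1) := by
      rw [Finset.mul_sum]
      refine Finset.sum_congr rfl fun p _ => ?_
      rw [dff_X]
      ring
    rw [e, show i + (j + 1) + 1 = i + 1 + j + 1 by omega]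
    simp only [dff_zero, mul_one, dff_X] at hv ⊢
    linear_combination (-divFF (i + 1)) * hv

theorem sum_range_eq_of_le {M : Type*} [AddCommMonoid M] {f : ℕ → M} {n m : ℕ} (h : n ≤ m)
    (hf : ∀ i, n ≤ i → f i = 0) : ∑ i ∈ Finset.range m, f i = ∑ i ∈ Finset.range n, f i := by
  refine (Finset.sum_subset (Finset.range_mono h) fun i _ hi => hf i ?_).symm
  simpa using hi

theorem sum_range_range_eq_antidiagonal {M : Type*} [AddCommMonoid M] {G : ℕ → ℕ → M}
    {L P Q : ℕ} (hP : L ≤ P) (hL : ∀ p q, L ≤ p + q → G p q = 0) (hQ : ∀ p q, Q ≤ q → G p q = 0) :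
    ∑ p ∈ Finset.range P, ∑ q ∈ Finset.range Q, G p q
      = ∑ k ∈ Finset.range L, ∑ p ∈ Finset.HasAntidiagonal.antidiagonal k, G p.1 p.2 := by
  simp only [Finset.Nat.sum_antidiagonal_eq_sum_range_succ G]
  rw [Finset.sum_range_diag_flip L G, sum_range_eq_of_le hP
    (fun p hp => Finset.sum_eq_zero fun q _ => hL p q (by omega))]
  refine Finset.sum_congr rfl fun p _ => ?_
  rw [← sum_range_eq_of_le (le_max_left Q (L - p)) (hQ p),
    sum_range_eq_of_le (le_max_right Q (L - p)) (fun q hq => hL p q (by omega))]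

end Identities

/-! ### Polynomials with coefficients in a module -/

section PolynomialModule

variable {M N : Type*} [AddCommGroup M] [Module Ch M] [AddCommGroup N] [Module Ch N]

theorem monomial_smul_const (k : ℕ) (r : Ch) (v : M) :
    monomial k r • const M v = PolynomialModule.lsingle Ch k (r • v) := by
  rw [const, PolynomialModule.monomial_smul_lsingle, add_zero]

/-- Frees `defSum` from the monomial basis, so that brackets can be summed directly in the basis
`divFF`. -/
theorem defSum_smul_const (A B : Module.End Ch M) (g : Ch[X]) (v : M) :
    defSum A B (g • const M v) = aeval B (indefSum g) v - aeval A (indefSum g) v := by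
  induction g using Polynomial.induction_on' with
  | add p q hp hq =>
    rw [add_smul, map_add, hp, hq, map_add, map_add, map_add, LinearMap.add_apply,
      LinearMap.add_apply]
    abel
  | monomial k r =>
    rw [monomial_smul_const, ← smul_X_eq_monomial]
    have e : PolynomialModule.coeffLinearEquiv Ch Ch (PolynomialModule.lsingle Ch k (r • v))
        = Finsupp.single k (r • v) := rfl
    rw [defSum, LinearMap.comp_apply, LinearEquiv.coe_coe, e, Finsupp.lsum_single]
    simp only [map_smul, LinearMap.smul_apply, LinearMap.sub_apply, smul_sub]

theorem subst_smul_const (ι : M →ₗ[Ch] N) (A : Module.End Ch N) (g : Ch[X]) (v : M) :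
    subst ι A (g • const M v) = aeval A g (ι v) := by
  induction g using Polynomial.induction_on' with
  | add p q hp hq => rw [add_smul, map_add, hp, hq, map_add, LinearMap.add_apply]
  | monomial k r =>
    have e : PolynomialModule.coeffLinearEquiv Ch Ch (PolynomialModule.lsingle Ch k (r • v))
        = Finsupp.single k (r • v) := rfl
    rw [monomial_smul_const, subst, LinearMap.comp_apply, LinearEquiv.coe_coe, e,
      Finsupp.lsum_single, aeval_monomial, ← Algebra.smul_def]
    simp

theorem mapCoeff_smul_const (f : M →ₗ[Ch] N) (g : Ch[X]) (v : M) :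
    mapCoeff f (g • const M v) = g • const N (f v) := by
  rw [mapCoeff, PolynomialModule.map_smul, Algebra.algebraMap_self, Polynomial.map_id, const,
    PolynomialModule.map_lsingle]
  rfl

theorem dff_mulVar (n : ℕ) (w : PolynomialModule Ch M) :
    dff (mulVar M) n w = divFF n • w := by
  rw [mulVar, ← dff_map, dff_X]
  rfl

theorem aeval_mulVar (g : Ch[X]) (w : PolynomialModule Ch M) :
    aeval (mulVar M) g w = g • w := by
  rw [mulVar, aeval_algHom_apply, aeval_X_left_apply]
  rfl

theorem aeval_mapCoeff (f : Module.End Ch M) (h g : Ch[X]) (v : M) :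
    aeval (mapCoeff f) h (g • const M v) = g • const M (aeval f h v) := by
  have hp (k : ℕ) (v : M) : (mapCoeff f ^ k) (g • const M v) = g • const M ((f ^ k) v) := by
    induction k generalizing v with
    | zero => rfl
    | succ k ih => rw [pow_succ, Module.End.mul_apply, mapCoeff_smul_const, ih]; rfl
  induction h using Polynomial.induction_on' with
  | add p q hp hq =>
    rw [map_add, LinearMap.add_apply, hp, hq, map_add, LinearMap.add_apply, map_add, smul_add]
  | monomial k r =>
    rw [aeval_monomial, aeval_monomial, ← Algebra.smul_def, ← Algebra.smul_def,
      LinearMap.smul_apply, LinearMap.smul_apply, hp, map_smul, smul_comm]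

theorem commute_mulVar_mapCoeff (f : Module.End Ch M) : Commute (mulVar M) (mapCoeff f) := by
  refine LinearMap.ext fun q => ?_
  change (X : Ch[X]) • mapCoeff f q = mapCoeff f ((X : Ch[X]) • q)
  rw [mapCoeff, PolynomialModule.map_smul, Polynomial.map_X]

theorem aeval_zero_indefSum (g : Ch[X]) : aeval (0 : Module.End Ch M) (indefSum g) = 0 := by
  rw [← coeff_zero_eq_aeval_zero', coeff_zero_eq_eval_zero, (indefSum_spec g).2, map_zero]

end PolynomialModule

namespace HVertexAlgebra

variable {V : Type*} [AddCommGroup V] [Module Ch V] (H : HVertexAlgebra V)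

/-! ### Noncommutative Wick formulas -/

theorem exists_bound (a b : V) : ∃ N : ℕ, ∀ j : ℤ, N ≤ j → H.Y a j b = 0 := by
  obtain ⟨N, hN⟩ := H.field a b
  exact ⟨N.toNat, fun j hj => hN j (by omega)⟩

theorem bracket_eq_sum {a b : V} {N : ℕ} (hN : ∀ j : ℕ, N ≤ j → H.Y a j b = 0) :
    H.bracket a b = ∑ j ∈ Finset.range N, divFF j • const V (H.Y a j b) := by
  change ∑ᶠ n : ℕ, H.bracketTerm a b n = _
  rw [finsum_eq_sum_of_support_subset (s := Finset.range N)]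
  · rfl
  · intro j hj
    rw [Finset.coe_range, Set.mem_Iio]
    by_contra h
    exact hj (by simp [bracketTerm, hN j (not_lt.mp h)])

/-- Multiplying `(1+ħz)^(T/ħ) v` by `(1+ħz)^k` shifts `T` by `kħ`; the index `-k - 1` selects the
coefficient of `z^k`. -/
theorem mulOneAdd_vac (k : ℕ) (v : V) :
    (mulOneAdd V ^ k) (H.Y v) (-k - 1) H.vac
      = dff (H.T + k • hbar • (1 : Module.End Ch V)) k v := by
  have hc : Commute H.T (k • hbar • (1 : Module.End Ch V)) :=
    ((Commute.one_right _).smul_right hbar).smul_right k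
  rw [mulOneAdd_pow_apply, LinearMap.sum_apply, add_comm H.T, dff_add hc.symm,
    LinearMap.sum_apply, Finset.Nat.sum_antidiagonal_eq_sum_range_succ_mk]
  refine Finset.sum_congr rfl fun i hi => ?_
  have hik : i ≤ k := Nat.lt_succ_iff.mp (Finset.mem_range.mp hi)
  have e : (-k - 1 + i : ℤ) = -(k - i : ℕ) - 1 := by
    push_cast [hik]
    ring_nf
  rw [e, dff_natCast_smul_hbar]
  simp [H.Y_vac]

/-- The commutator `[a_(-1), b_(-1)]` on the vacuum produces `(T + (j+1)ħ)_{j+1}` on `a_(j) b`;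
reflection turns it into `(-T-ħ)_{j+1}`, the lower extreme of the sum. -/
theorem star_sub_star (a b : V) :
    H.star a b - H.star b a = defSum (-H.T - hbar • 1) 0 (H.bracket a b) := by
  obtain ⟨N₁, h₁⟩ := H.isLocal a b
  obtain ⟨N₂, h₂⟩ := H.exists_bound a b
  obtain ⟨N, hN₁, hN₂⟩ : ∃ N, N₁ ≤ N ∧ N₂ ≤ N := ⟨N₁ + N₂, by omega, by omega⟩
  have h := congrArg (fun φ : Module.End Ch V => φ H.vac)
    (eq_sum_neg_one_of_local (pow_apply_eq_zero_of_le hN₁ h₁) (-1))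
  have e : Dist.comm (H.Y a) (H.Y b) (-1) (-1) H.vac = H.star a b - H.star b a := by
    simp [Dist.comm, H.vac_right_zero, star_apply]
  rw [H.bracket_eq_sum (N := N) fun j hj => h₂ j (by omega), map_sum, ← e, h,
    LinearMap.sum_apply]
  refine Finset.sum_congr rfl fun j _ => ?_
  rw [defSum_smul_const, aeval_zero_indefSum, indefSum_divFF, LinearMap.zero_apply, zero_sub,
    H.product_eq]
  change _ = -(dff (-H.T - hbar • (1 : Module.End Ch V)) (j + 1) _)
  rw [dff_neg_sub_hbar, LinearMap.smul_apply, LinearMap.smul_apply, ← H.mulOneAdd_vac,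
    pow_succ (-1 : ℤ) j, mul_neg_one, neg_smul, neg_neg]
  congr 4
  push_cast
  ring_nf

theorem dff_T₁ (n : ℕ) (a v : V) :
    dff H.T₁ n (TensorProduct.mk Ch V V a v) = TensorProduct.mk Ch V V (dff H.T n a) v := by
  have key (p : Ch[X]) : aeval H.T₁ p (TensorProduct.mk Ch V V a v)
      = TensorProduct.mk Ch V V (aeval H.T p a) v := by
    have hp (k : ℕ) (a : V) : (H.T₁ ^ k) (TensorProduct.mk Ch V V a v)
        = TensorProduct.mk Ch V V ((H.T ^ k) a) v := by
      induction k generalizing a with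
      | zero => rfl
      | succ k ih =>
        rw [pow_succ, Module.End.mul_apply, pow_succ, Module.End.mul_apply, ← ih]
        rfl
    induction p using Polynomial.induction_on' with
    | add p q hp hq =>
      rw [map_add, LinearMap.add_apply, hp, hq, map_add, LinearMap.add_apply, map_add,
        LinearMap.add_apply]
    | monomial k r =>
      rw [aeval_monomial, aeval_monomial, ← Algebra.smul_def, ← Algebra.smul_def,
        LinearMap.smul_apply, LinearMap.smul_apply, hp, map_smul, LinearMap.smul_apply]
  exact key _

theorem sumStar_eq_sum (b : V) {a c : V} {N : ℕ} (hN : ∀ j : ℕ, N ≤ j → H.Y a j c = 0) :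
    H.sumStar b (H.bracket a c)
      = ∑ j ∈ Finset.range N, H.Y b (-j - 2) (H.Y a j c) := by
  rw [sumStar, H.bracket_eq_sum hN, map_sum, map_sum, map_sum]
  refine Finset.sum_congr rfl fun j _ => ?_
  rw [mapCoeff_smul_const, defSum_smul_const, aeval_zero_indefSum, indefSum_divFF,
    LinearMap.zero_apply, sub_zero]
  change H.starTensor (dff H.T₁ (j + 1) _) = _
  rw [dff_T₁, starTensor, TensorProduct.mk_apply, TensorProduct.lift.tmul, star_apply, star_dff]
  congr 2
  push_cast
  ring_nf

theorem star_star_sub (a b c : V) :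
    H.star (H.star a b) c - H.star a (H.star b c)
      = H.sumStar b (H.bracket a c) + H.sumStar a (H.bracket b c) := by
  obtain ⟨N₁, h₁⟩ := H.exists_bound a c
  obtain ⟨N₂, h₂⟩ := H.exists_bound b c
  obtain ⟨N, hN₁, hN₂⟩ : ∃ N, N₁ ≤ N ∧ N₂ ≤ N := ⟨N₁ + N₂, by omega, by omega⟩
  rw [H.sumStar_eq_sum (N := N) b fun j hj => h₁ j (by omega),
    H.sumStar_eq_sum (N := N) a fun j hj => h₂ j (by omega), star_apply,
    -- The bound `N + 1` leaves `N` terms once the `j = 0` creation term, equal to `a ∗ (b ∗ c)`, is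
    -- removed.
    H.Y_star_apply a b c (-1) (N + 1) (fun j hj => h₁ j (by omega))
      (fun j hj => h₂ _ (by omega)), Finset.sum_add_distrib, Finset.sum_range_succ',
    Finset.sum_range_succ (fun j : ℕ => H.Y b (-1 - 1 - j) (H.Y a j c)), h₁ N (by omega),
    map_zero, add_zero, star_apply, star_apply]
  have e₁ (j : ℕ) : H.Y a (-((j + 1 : ℕ) : ℤ) - 1) (H.Y b (-1 + ((j + 1 : ℕ) : ℤ)) c)
      = H.Y a (-j - 2) (H.Y b j c) := by
    congr 3
    · push_cast; ring_nf
    · push_cast; ring_nf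
  have e₂ (j : ℕ) : H.Y b (-1 - 1 - j) (H.Y a j c) = H.Y b (-j - 2) (H.Y a j c) := by
    congr 2
    ring_nf
  simp only [e₁, e₂]
  simp
  abel

/-- The commutator `[a_{(m)}, b_{(-1)}]` for `m ≥ 0`. -/
theorem comm_star {a b : V} {N : ℕ}
    (hN : (zw (Module.End Ch V) ^ N) (Dist.comm (H.Y a) (H.Y b)) = 0) (m : ℕ) (c : V) :
    H.Y a m (H.star b c) - H.star b (H.Y a m c)
      = ∑ j ∈ Finset.range N, ∑ i ∈ Finset.range (j + 2), m.choose j • (j + 1).choose i • hbar ^ i •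
          H.Y (H.Y a j b) (m - 1 - j + i) c := by
  have h := congrArg (fun φ : Module.End Ch V => φ c) (eq_sum_choose_of_local hN m (-1))
  have e : Dist.comm (H.Y a) (H.Y b) m (-1) c = H.Y a m (H.star b c) - H.star b (H.Y a m c) := by
    simp [Dist.comm, star_apply]
  rw [← e, h, LinearMap.sum_apply]
  refine Finset.sum_congr rfl fun j _ => ?_
  rw [H.product_eq, mulOneAdd_pow_apply, Finset.smul_sum, LinearMap.sum_apply]
  refine Finset.sum_congr rfl fun i _ => ?_
  simp only [LinearMap.smul_apply, ← sub_eq_add_neg]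

theorem bracketLeft_eq_sum (c v : V) (j : ℕ) {L : ℕ} (hL : ∀ k : ℕ, L ≤ k → H.Y v k c = 0) :
    defSum 0 (mulVar V + hbar • 1) (H.bracketLeft (divFF j • const V v) c)
      = ∑ k ∈ Finset.range L, (dff ((X : Ch[X]) + hbar • (1 : Ch[X])) (k + 1) * divFF j) •
          const V (H.Y v k c) := by
  rw [bracketLeft, mapCoeff_smul_const, subst_smul_const, LinearMap.flip_apply,
    H.bracket_eq_sum hL]
  simp only [map_sum]
  refine Finset.sum_congr rfl fun k _ => ?_
  rw [mapCoeff_smul_const, aeval_mapCoeff, defSum_smul_const, aeval_zero_indefSum,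
    indefSum_divFF, LinearMap.zero_apply, sub_zero, aeval_mulVar]
  change dff (mulVar V + hbar • 1) (k + 1) _ = _
  have e : mulVar V + hbar • 1
      = Algebra.lsmul Ch Ch (PolynomialModule Ch V) ((X : Ch[X]) + hbar • (1 : Ch[X])) := by
    rw [map_add, map_smul, map_one, mulVar]
  rw [e, ← dff_map, mul_smul]
  rfl

/-- In the generating series of `[a_(m), b_(-1)] c`, put `m = p + j` and extract `(λ)_j/j!`.
Chu–Vandermonde merges `(λ-jħ)_p` with `((j+1)ħ)_i`, the expansion of `(1+ħw)^(j+1)`, into `(λ+ħ)_k`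
with `k = p + i`. The term `k = 0` is `[a_λ b] ∗ c`; the terms `k ≥ 1` form the sum up to `λ + ħ`.
-/
theorem bracket_star_right (a b c : V) :
    H.bracket a (H.star b c)
      = mapCoeff (H.star b) (H.bracket a c) + mapCoeff (H.star.flip c) (H.bracket a b)
        + defSum 0 (mulVar V + hbar • 1) (H.bracketLeft (H.bracket a b) c) := by
  obtain ⟨N₁, h₁⟩ := H.isLocal a b
  obtain ⟨N₂, h₂⟩ := H.exists_bound a b
  obtain ⟨N, hN₁, hN₂⟩ : ∃ N, N₁ ≤ N ∧ N₂ ≤ N := ⟨N₁ + N₂, by omega, by omega⟩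
  replace h₁ := pow_apply_eq_zero_of_le hN₁ h₁
  obtain ⟨K₁, hK₁⟩ := H.exists_bound a c
  obtain ⟨K₂, hK₂⟩ := H.exists_bound a (H.star b c)
  choose L₀ hL₀ using fun j : ℕ => H.exists_bound (H.Y a j b) c
  obtain ⟨L, hL⟩ : ∃ L, ∀ j < N, L₀ j ≤ L :=
    ⟨∑ j ∈ Finset.range N, L₀ j, fun j hj =>
      Finset.single_le_sum (fun _ _ => Nat.zero_le _) (Finset.mem_range.mpr hj)⟩
  -- With `K = j + P` and `j < N` this leaves `P ≥ L + 1`, enough for all diagonals `k ≤ L` that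
  -- contribute.
  obtain ⟨K, hKa, hKb, hKN⟩ : ∃ K, K₁ ≤ K ∧ K₂ ≤ K ∧ N + (L + 1) ≤ K :=
    ⟨K₁ + K₂ + (N + (L + 1)), by omega, by omega, by omega⟩
  have hab : H.bracket a b = _ := H.bracket_eq_sum (N := N) fun j hj => h₂ j (by omega)
  have hbl : H.bracketLeft (H.bracket a b) c
      = ∑ j ∈ Finset.range N, H.bracketLeft (divFF j • const V (H.Y a j b)) c := by
    rw [hab, bracketLeft, map_sum, map_sum]
    rfl
  rw [H.bracket_eq_sum (N := K) fun j hj => hK₂ j (by omega),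
    H.bracket_eq_sum (N := K) fun j hj => hK₁ j (by omega), hbl, hab, map_sum, map_sum, map_sum,
    add_assoc, ← sub_eq_iff_eq_add', ← Finset.sum_sub_distrib, ← Finset.sum_add_distrib]
  have hm (m : ℕ) : divFF m • const V (H.Y a m (H.star b c))
      - mapCoeff (H.star b) (divFF m • const V (H.Y a m c))
      = ∑ j ∈ Finset.range N, ∑ i ∈ Finset.range (j + 2),
          (m.choose j • divFF m * dff ((j + 1) • hbar • (1 : Ch[X])) i) •
            const V (H.Y (H.Y a j b) (m - 1 - j + i) c) := by
    rw [mapCoeff_smul_const, ← smul_sub, ← map_sub, H.comm_star h₁, map_sum, Finset.smul_sum]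
    refine Finset.sum_congr rfl fun j _ => ?_
    rw [map_sum, Finset.smul_sum]
    refine Finset.sum_congr rfl fun i _ => ?_
    rw [dff_natCast_smul_hbar, map_nsmul, map_nsmul, map_smul]
    simp only [mul_smul, smul_assoc, one_smul]
    rw [smul_comm (divFF m) (m.choose j), smul_comm (divFF m) ((j + 1).choose i),
      smul_comm (divFF m) (hbar ^ i)]
  simp only [hm]
  rw [Finset.sum_comm]
  refine Finset.sum_congr rfl fun j hj => ?_
  have hjN : j < N := Finset.mem_range.mp hj
  set v := H.Y a j b with hv
  have hvL (k : ℤ) (hk : (L : ℤ) ≤ k) : H.Y v k c = 0 :=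
    hL₀ j k (by have := hL j hjN; omega)
  rw [H.bracketLeft_eq_sum c v j (L := L) fun k hk => hvL k (by omega), mapCoeff_smul_const,
    LinearMap.flip_apply, star_apply]
  let G : ℕ → ℕ → PolynomialModule Ch V := fun p i =>
    (divFF j * (dff ((X : Ch[X]) - j • hbar • (1 : Ch[X])) p
      * dff ((j + 1) • hbar • (1 : Ch[X])) i)) • const V (H.Y v (p + i - 1) c)
  obtain ⟨P, rfl⟩ : ∃ P, K = j + P := ⟨K - j, by omega⟩
  have hl : ∑ m ∈ Finset.range (j + P), ∑ i ∈ Finset.range (j + 2),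
      (m.choose j • divFF m * dff ((j + 1) • hbar • (1 : Ch[X])) i) •
        const V (H.Y v (m - 1 - j + i) c)
      = ∑ p ∈ Finset.range P, ∑ i ∈ Finset.range (j + 2), G p i := by
    rw [Finset.sum_range_add, Finset.sum_eq_zero, zero_add]
    · refine Finset.sum_congr rfl fun p _ => Finset.sum_congr rfl fun i _ => ?_
      rw [add_comm j p, choose_smul_divFF, mul_assoc]
      simp only [G]
      congr 5
      push_cast
      ring_nf
    · intro m hm
      refine Finset.sum_eq_zero fun i _ => ?_
      rw [Nat.choose_eq_zero_of_lt (Finset.mem_range.mp hm)]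
      simp
  rw [hl, sum_range_range_eq_antidiagonal (L := L + 1) (by omega)]
  · have hk (k : ℕ) : ∑ p ∈ Finset.HasAntidiagonal.antidiagonal k, G p.1 p.2
        = (dff ((X : Ch[X]) + hbar • (1 : Ch[X])) k * divFF j) • const V (H.Y v (k - 1) c) := by
      have e : (X : Ch[X]) + hbar • (1 : Ch[X])
          = ((X : Ch[X]) - j • hbar • (1 : Ch[X])) + (j + 1) • hbar • (1 : Ch[X]) := by module
      rw [e, dff_add (Commute.all _ _), mul_comm, Finset.mul_sum, Finset.sum_smul]
      refine Finset.sum_congr rfl fun p hp => ?_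
      simp only [G]
      rw [← Finset.HasAntidiagonal.mem_antidiagonal.mp hp]
      push_cast
      rfl
    simp only [hk]
    rw [Finset.sum_range_succ', add_comm]
    simp [dff_zero]
  · intro p q hpq
    simp only [G]
    rw [hvL _ (by omega), map_zero, smul_zero]
  · intro p q hq
    simp only [G]
    rw [dff_natCast_smul_hbar, Nat.choose_eq_zero_of_lt (by omega)]
    simp

/-- Since `λ` and `T₁` commute, Chu–Vandermonde splits `(λ + T₁)_k`; the powers of `T` acting on `a`
become negative modes by `star_dff`. -/
theorem starShift_eq_sum (a : V) {b c : V} {N : ℕ} (hN : ∀ j : ℕ, N ≤ j → H.Y b j c = 0) :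
    H.starShift a (H.bracket b c) = ∑ k ∈ Finset.range N,
      ∑ p ∈ Finset.HasAntidiagonal.antidiagonal k,
        divFF p.1 • const V (H.Y a (-p.2 - 1) (H.Y b k c)) := by
  rw [starShift, H.bracket_eq_sum hN, map_sum, map_sum, map_sum]
  refine Finset.sum_congr rfl fun k _ => ?_
  rw [mapCoeff_smul_const, subst_smul_const]
  change mapCoeff _ (dff (mulVar (TensorProduct Ch V V) + mapCoeff H.T₁ : Module.End Ch _) k _) = _
  rw [dff_add (commute_mulVar_mapCoeff _), LinearMap.sum_apply, map_sum]
  refine Finset.sum_congr rfl fun p _ => ?_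
  have e : dff (mapCoeff H.T₁) p.2 (const _ (TensorProduct.mk Ch V V a (H.Y b k c)))
      = const _ (dff H.T₁ p.2 (TensorProduct.mk Ch V V a (H.Y b k c))) := by
    have := aeval_mapCoeff H.T₁ (divFF p.2) 1 (TensorProduct.mk Ch V V a (H.Y b k c))
    rwa [one_smul, one_smul] at this
  rw [Module.End.mul_apply, e, dff_mulVar, mapCoeff_smul_const, dff_T₁, starTensor,
    TensorProduct.mk_apply, TensorProduct.lift.tmul, star_apply, star_dff]

theorem bracketRight_eq_sum (b v : V) (j : ℕ) {I : ℕ} (hI : ∀ i : ℕ, I ≤ i → H.Y b i v = 0) :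
    defSum 0 (mulVar V) (H.bracketRight b (divFF j • const V v))
      = ∑ i ∈ Finset.range I, divFF (i + j + 1) • const V (H.Y b i v) := by
  rw [bracketRight, mapCoeff_smul_const, subst_smul_const, H.bracket_eq_sum hI]
  simp only [map_sum]
  refine Finset.sum_congr rfl fun i _ => ?_
  let W := PolynomialModule Ch V
  let M : Module.End Ch (PolynomialModule Ch W) :=
    Algebra.lsmul Ch Ch (PolynomialModule Ch W) (-X - hbar • (1 : Ch[X]))
  -- Splitting `λ - μ - ħ` into `λ` and `-μ - ħ` leaves a sum over `μ` given by `betaSum`.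
  have hM : mapCoeff (mulVar V) - mulVar W - hbar • 1 = mapCoeff (mulVar V) + M := by
    simp only [M, map_sub, map_neg, map_smul, map_one, mulVar]
    abel
  have hc : Commute (mapCoeff (mulVar V)) M := by
    have h1 : M = -mulVar W - hbar • 1 := by
      simp only [M, map_sub, map_neg, map_smul, map_one, mulVar]
    rw [h1]
    exact ((commute_mulVar_mapCoeff (mulVar V)).symm.neg_right).sub_right
      ((Commute.one_right _).smul_right hbar)
  rw [mapCoeff_smul_const, hM]
  change defSum 0 (mulVar V) (dff (mapCoeff (mulVar V) + M) j _) = _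
  rw [dff_add hc, LinearMap.sum_apply, map_sum, ← sum_betaSum_mul_divFF, Finset.sum_smul]
  refine Finset.sum_congr rfl fun p _ => ?_
  have e1 : dff M p.2 (divFF i • const W (const V (H.Y b i v)))
      = (dff (-X - hbar • (1 : Ch[X])) p.2 * divFF i) • const W (const V (H.Y b i v)) := by
    rw [← dff_map, mul_smul]
    rfl
  have e2 (g : Ch[X]) (w : W) : dff (mapCoeff (mulVar V)) p.1 (g • const W w)
      = g • const W (divFF p.1 • w) := by
    rw [dff, aeval_mapCoeff, aeval_mulVar]
  rw [Module.End.mul_apply, e1, e2, defSum_smul_const, indefSum_betaSum, ← indefSum_betaSum,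
    aeval_zero_indefSum, indefSum_betaSum, LinearMap.zero_apply, sub_zero, aeval_mulVar, mul_smul]

/-- In the modes `m ≥ 0` of `:Y(a)Y(b):` the creation half of `a` gives `a ∗ [b_{λ+T} c]`. The other
half involves `b_(m-1-j) a_(j) c`: negative modes of `b` give `b ∗ [a_{λ+T} c]`, and nonnegative
ones the iterated bracket. -/
theorem bracket_star_left (a b c : V) :
    H.bracket (H.star a b) c
      = H.starShift a (H.bracket b c) + H.starShift b (H.bracket a c)
        + defSum 0 (mulVar V) (H.bracketRight b (H.bracket a c)) := by
  obtain ⟨L₁, h₁⟩ := H.exists_bound a c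
  obtain ⟨L₂, h₂⟩ := H.exists_bound b c
  obtain ⟨K₀, hK₀⟩ := H.exists_bound (H.star a b) c
  obtain ⟨L, hL₁, hL₂⟩ : ∃ L, L₁ ≤ L ∧ L₂ ≤ L := ⟨L₁ + L₂, by omega, by omega⟩
  choose I₀ hI₀ using fun j : ℕ => H.exists_bound b (H.Y a j c)
  obtain ⟨I, hI⟩ : ∃ I, ∀ j < L, I₀ j ≤ I :=
    ⟨∑ j ∈ Finset.range L, I₀ j, fun j hj =>
      Finset.single_le_sum (fun _ _ => Nat.zero_le _) (Finset.mem_range.mpr hj)⟩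
  obtain ⟨K, hKK, hKL⟩ : ∃ K, K₀ ≤ K ∧ L + I ≤ K := ⟨K₀ + (L + I), by omega, by omega⟩
  have hac : H.bracket a c = _ := H.bracket_eq_sum (N := L) fun j hj => h₁ j (by omega)
  have hbr : H.bracketRight b (H.bracket a c)
      = ∑ j ∈ Finset.range L, H.bracketRight b (divFF j • const V (H.Y a j c)) := by
    rw [hac, bracketRight, map_sum, map_sum]
    rfl
  rw [H.bracket_eq_sum (N := K) fun j hj => hK₀ j (by omega),
    H.starShift_eq_sum a (N := L) fun j hj => h₂ j (by omega),
    H.starShift_eq_sum b (N := L) fun j hj => h₁ j (by omega), hbr, map_sum, add_assoc,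
    ← Finset.sum_add_distrib]
  have hm (m : ℕ) : divFF m • const V (H.Y (H.star a b) m c)
      = ∑ j ∈ Finset.range L, divFF m • const V (H.Y a (-j - 1) (H.Y b (m + j) c))
        + ∑ j ∈ Finset.range L, divFF m • const V (H.Y b (m - 1 - j) (H.Y a j c)) := by
    rw [H.Y_star_apply a b c m L (fun j hj => h₁ j (by omega)) (fun j hj => h₂ _ (by omega)),
      map_sum, Finset.smul_sum, ← Finset.sum_add_distrib]
    refine Finset.sum_congr rfl fun j _ => ?_
    rw [map_add, smul_add]
  simp only [hm]
  rw [Finset.sum_add_distrib]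
  congr 1
  · rw [sum_range_range_eq_antidiagonal (L := L) (by omega)
      (G := fun m j : ℕ => divFF m • const V (H.Y a (-j - 1) (H.Y b (m + j) c)))]
    · refine Finset.sum_congr rfl fun k _ => Finset.sum_congr rfl fun p hp => ?_
      rw [← Finset.HasAntidiagonal.mem_antidiagonal.mp hp]
      push_cast
      rfl
    · intro p q hpq
      rw [h₂ _ (by omega), map_zero, map_zero, smul_zero]
    · intro p q hq
      rw [h₂ _ (by omega), map_zero, map_zero, smul_zero]
  · rw [Finset.sum_comm]
    refine Finset.sum_congr rfl fun j hj => ?_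
    have hjL : j < L := Finset.mem_range.mp hj
    have hbI (i : ℤ) (hi : (I : ℤ) ≤ i) : H.Y b i (H.Y a j c) = 0 :=
      hI₀ j i (by have := hI j hjL; omega)
    -- The cut at `m = j + 1` is where `m - 1 - j` becomes nonnegative; beyond it `m = i + j + 1`
    -- matches the beta integral.
    rw [H.bracketRight_eq_sum b _ j (I := I) fun i hi => hbI i (by omega),
      sum_range_eq_of_le (n := j + 1 + I) (by omega)
        (fun m hm => by rw [hbI _ (by omega), map_zero, smul_zero]), Finset.sum_range_add,
      Finset.Nat.sum_antidiagonal_eq_sum_range_succ_mk]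
    congr 1
    · refine Finset.sum_congr rfl fun m hm => ?_
      have hmj : m ≤ j := Nat.lt_succ_iff.mp (Finset.mem_range.mp hm)
      congr 4
      push_cast [hmj]
      ring_nf
    · refine Finset.sum_congr rfl fun i _ => ?_
      rw [show j + 1 + i = i + j + 1 by omega]
      congr 4
      push_cast
      ring_nf

end HVertexAlgebra

end HbarVA

end

theorem mainTheorem6 {V : Type*} [AddCommGroup V] [Module HbarVA.Ch V]
    (H : HbarVA.HVertexAlgebra V) :
    (∀ a b : V,
      H.star a b - H.star b a = HbarVA.defSum (-H.T - HbarVA.hbar • 1) 0 (H.bracket a b)) ∧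
    (∀ a b c : V,
      H.star (H.star a b) c - H.star a (H.star b c)
        = H.sumStar b (H.bracket a c) + H.sumStar a (H.bracket b c)) ∧
    (∀ a b c : V,
      H.bracket a (H.star b c)
        = HbarVA.mapCoeff (H.star b) (H.bracket a c)
          + HbarVA.mapCoeff (H.star.flip c) (H.bracket a b)
          + HbarVA.defSum 0 (HbarVA.mulVar V + HbarVA.hbar • 1)
              (H.bracketLeft (H.bracket a b) c)) ∧
    (∀ a b c : V,
      H.bracket (H.star a b) c
        = H.starShift a (H.bracket b c) + H.starShift b (H.bracket a c)
          + HbarVA.defSum 0 (HbarVA.mulVar V) (H.bracketRight b (H.bracket a c))) := by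
  exact ⟨H.star_sub_star, H.star_star_sub, H.bracket_star_right, H.bracket_star_left⟩
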